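/- **Theorem.** Let $Q(x,u,v,y;\alpha,\beta)$ be a bulk polynomial of the Adler–Bobenko–Suris (ABS) list, that is, one of the following polynomials ($\delta\in\mathbb C$ arbitrary) - Q1($\delta$): $\alpha(x-v)(u-y)-\beta(x-u)(v-y)+\delta^2\alpha\beta(\alpha-\beta)$, - Q2: $\alpha(x-v)(u-y)-\beta(x-u)(v-y)+\alpha\beta(\alpha-\beta)(x+u+v+y)-\alpha\beta(\alpha-\beta)(\alpha^2-\alpha\beta+\beta^2)$, - Q3($\delta$): $\sinh(\alpha)(xu+vy)-\sinh(\beta)(xv+uy)-\sinh(\alpha-\beta)(xy+uv)+\delta\sinh(\alpha-\beta)\sinh(\alpha)\sinh(\beta)$, - Q4: $\mathrm{sn}(\alpha)(xu+vy)-\mathrm{sn}(\beta)(xv+uy)-\mathrm{sn}(\alpha-\beta)(xy+uv)+\mathrm{sn}(\alpha-\beta)\,\mathrm{sn}(\alpha)\,\mathrm{sn}(\beta)(1+k^2xuvy)$, with $\mathrm{sn}$ the Jacobi elliptic function of modulus $k=\theta_2(0|\tau)^2/\theta_3(0|\tau)^2$, $\operatorname{Im}\tau>0$ (every $k\ne 0,\pm1$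 is of this form), - H1: $(x-y)(u-v)+\beta-\alpha$, - H2: $(x-y)(u-v)+(\beta-\alpha)(x+u+v+y)+\beta^2-\alpha^2$, - H3($\delta$): $e^{\alpha}(xu+vy)-e^{\beta}(xv+uy)+\delta(e^{2\alpha}-e^{2\beta})$, - A1($\delta$): $\alpha(x+v)(u+y)-\beta(x+u)(v+y)-\delta^2\alpha\beta(\alpha-\beta)$, - A2: $\sinh(\alpha)(xv+uy)-\sinh(\beta)(xu+vy)-\sinh(\alpha-\beta)(1+xuvy)$, or the polynomial obtained from one of them by applying one Möbius transformation to all four arguments and clearing denominators. Let $\alpha_1,\dots,\alpha_4\in\mathbb C$ be such that for all $i\neq j$ the polynomial $Q(x,u,v,y;\alpha_i,\alpha_j)$ is irreducible in $\mathbb C[x,u,v,y]$; for Q4 assume also that no $\alpha_i$ and no $\alpha_i-\alpha_j$ ($i\ne j$) is a pole of $\mathrm{sn}$. The equation $Q=0$ is understood for arguments in $\mathbb{CP}^1$. Consider the rhombic dodecahedron with the vertices $x$; $x_1,x_2,x_3,x_4$; $x_{12},x_{23},x_{34},x_{14}$; $x_{124},x_{123},x_{234},x_{134}$; $x_{1234}$,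 whose faces carry, for every four cyclically consecutive indices $i,j,k,l$ modulo $4$, the equations $$Q(x,x_i,x_j,x_{ij};\alpha_i,\alpha_j)=0,\qquad Q(x_j,x_{ij},x_{jk},x_{ijk};\alpha_i,\alpha_k)=0,\qquad Q(x_{jk},x_{ijk},x_{jkl},x_{1234};\alpha_i,\alpha_l)=0 .$$ From initial values $x,x_1,x_2,x_3,x_4$ the first equations give the $x_{ij}$, the second ones the $x_{ijk}$, and each of the four equations of the third kind gives a value of $x_{1234}$. Then $Q=0$ is consistent around the rhombic dodecahedron: 1. for all initial values $x,x_1,\dots,x_4\in\mathbb{CP}^1$, any two of these four ways of computing $x_{1234}$ all of whose steps are uniquely solvable give the same $x_{1234}$; 2. there is a nonzero polynomial $P$ on $\mathbb C^5$ such that for all initial values $(x,x_1,\dots,x_4)\in\mathbb C^5$ with $P(x,x_1,\dots,x_4)\neq0$ all steps of the four ways are uniquely solvable, so that all four give one and the same $x_{1234}\in\mathbb{CP}^1$. -/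

import Mathlib

open scoped BigOperators

noncomputable section

namespace ABS

/-! ### The Jacobi elliptic function `sn`, as a quotient of theta functions

The parameter is a point `τ` of the upper half plane (nome `exp (π i τ)`). With Mathlib's
`jacobiTheta₂ z τ = ∑ₙ exp (2 π i n z + π i n² τ)` the classical theta functions in the variable
`ζ = π z` are the following ones. -/

/-- The theta function `θ₃`, in the variable `z = ζ / π`. -/
def theta3 (τ : UpperHalfPlane) (z : ℂ) : ℂ := jacobiTheta₂ z τ

/-- The theta function `θ₄(ζ) = θ₃(ζ + π/2)`, in the variable `z = ζ / π`. -/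
def theta4 (τ : UpperHalfPlane) (z : ℂ) : ℂ := jacobiTheta₂ (z + 1 / 2) τ

/-- The theta function `θ₂`, in the variable `z = ζ / π`. -/
def theta2 (τ : UpperHalfPlane) (z : ℂ) : ℂ :=
  Complex.exp (Real.pi * Complex.I * τ / 4 + Real.pi * Complex.I * z)
    * jacobiTheta₂ (z + τ / 2) τ

/-- The theta function `θ₁(ζ) = θ₂(ζ - π/2)`, in the variable `z = ζ / π`. -/
def theta1 (τ : UpperHalfPlane) (z : ℂ) : ℂ := theta2 τ (z - 1 / 2)

/-- The elliptic modulus `k = θ₂(0)² / θ₃(0)²`. When `τ` runs through the upper half plane,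
`k` takes exactly the values different from `0`, `1` and `-1`. -/
def modulus (τ : UpperHalfPlane) : ℂ := theta2 τ 0 ^ 2 / theta3 τ 0 ^ 2

/-- The variable `z = ζ / π`, where `ζ = a / θ₃(0)²`. -/
def thetaArg (τ : UpperHalfPlane) (a : ℂ) : ℂ := a / (Real.pi * theta3 τ 0 ^ 2)

/-- The Jacobi elliptic function `sn` of modulus `modulus τ`:
`sn a = (θ₃(0) / θ₂(0)) * (θ₁(ζ) / θ₄(ζ))` with `ζ = a / θ₃(0)²`.
Its poles are the zeros of the denominator `θ₄(ζ)`. -/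
def sn (τ : UpperHalfPlane) (a : ℂ) : ℂ :=
  theta3 τ 0 / theta2 τ 0 * (theta1 τ (thetaArg τ a) / theta4 τ (thetaArg τ a))

/-! ### The list of bulk polynomials -/

/-- The names of the canonical forms. The continuous parameters are `δ` and, for `Q4`, the elliptic
modulus, given through `τ`. -/
inductive CanonicalForm : Type
  | Q1 (δ : ℂ)
  | Q2
  | Q3 (δ : ℂ)
  | Q4 (τ : UpperHalfPlane)
  | H1
  | H2
  | H3 (δ : ℂ)
  | A1 (δ : ℂ)
  | A2

open MvPolynomial in
/-- The canonical bulk polynomials `Q(x, u, v, y; α, β)`, as polynomials in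
`x = X 0`, `u = X 1`, `v = X 2`, `y = X 3`. -/
def CanonicalForm.poly (F : CanonicalForm) (α β : ℂ) : MvPolynomial (Fin 4) ℂ :=
  let x : MvPolynomial (Fin 4) ℂ := X 0
  let u : MvPolynomial (Fin 4) ℂ := X 1
  let v : MvPolynomial (Fin 4) ℂ := X 2
  let y : MvPolynomial (Fin 4) ℂ := X 3
  match F with
  | .Q1 δ => C α * ((x - v) * (u - y)) - C β * ((x - u) * (v - y)) + C (δ ^ 2 * α * β * (α - β))
  | .Q2 => C α * ((x - v) * (u - y)) - C β * ((x - u) * (v - y))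
      + C (α * β * (α - β)) * (x + u + v + y)
      - C (α * β * (α - β) * (α ^ 2 - α * β + β ^ 2))
  | .Q3 δ => C (Complex.sinh α) * (x * u + v * y) - C (Complex.sinh β) * (x * v + u * y)
      - C (Complex.sinh (α - β)) * (x * y + u * v)
      + C (δ * Complex.sinh (α - β) * Complex.sinh α * Complex.sinh β)
  | .Q4 τ => C (sn τ α) * (x * u + v * y) - C (sn τ β) * (x * v + u * y)
      - C (sn τ (α - β)) * (x * y + u * v)
      + C (sn τ (α - β) * sn τ α * sn τ β) * (1 + C (modulus τ ^ 2) * (x * u * v * y))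
  | .H1 => (x - y) * (u - v) + C (β - α)
  | .H2 => (x - y) * (u - v) + C (β - α) * (x + u + v + y) + C (β ^ 2 - α ^ 2)
  | .H3 δ => C (Complex.exp α) * (x * u + v * y) - C (Complex.exp β) * (x * v + u * y)
      + C (δ * (Complex.exp (2 * α) - Complex.exp (2 * β)))
  | .A1 δ => C α * ((x + v) * (u + y)) - C β * ((x + u) * (v + y)) - C (δ ^ 2 * α * β * (α - β))
  | .A2 => C (Complex.sinh α) * (x * v + u * y) - C (Complex.sinh β) * (x * u + v * y)
      - C (Complex.sinh (α - β)) * (1 + x * u * v * y)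

/-- The coefficient functions of the canonical form are defined at the parameter value `a`: for `Q4`,
`sn` has no pole at `a`; there is no condition in the other cases. -/
def CanonicalForm.DefinedAt (F : CanonicalForm) (a : ℂ) : Prop :=
  match F with
  | .Q4 τ => theta4 τ (thetaArg τ a) ≠ 0
  | _ => True

/-! ### Homogenization, Möbius transformations, and equations over the projective line -/

/-- Homogenization of a polynomial `p` in four variables of degree at most one in each of them,
evaluated at the homogeneous coordinates `(a i : b i)`: in every monomial the variable number `i` is
replaced by `a i` if it occurs, and the factor `b i` is inserted if it does not occur. -/
def homEval {R : Type} [CommRing R] [Algebra ℂ R] (p : MvPolynomial (Fin 4) ℂ) (a b : Fin 4 → R) :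
    R :=
  ∑ S : Finset (Fin 4),
    algebraMap ℂ R (p.coeff (∑ i ∈ S, Finsupp.single i 1)) * ∏ i, if i ∈ S then a i else b i

open MvPolynomial in
/-- The polynomial `Q_m = Λ(x) Λ(u) Λ(v) Λ(y) Q(m(x), m(u), m(v), m(y))`, for the Möbius transformation
`m(z) = (m₁ z + m₂) / (m₃ z + m₄)` with invertible matrix `m`, where `Λ(z) = m₃ z + m₄`. -/
def mobius (m : GL (Fin 2) ℂ) (p : MvPolynomial (Fin 4) ℂ) : MvPolynomial (Fin 4) ℂ :=
  homEval p (fun i => C (m.1 0 0) * X i + C (m.1 0 1)) (fun i => C (m.1 1 0) * X i + C (m.1 1 1))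

/-- The bulk polynomial `Q(x, u, v, y; α, β)` obtained from a canonical form by a simultaneous Möbius
transformation of its four arguments (the canonical form itself for `m = 1`). -/
def bulk (F : CanonicalForm) (m : GL (Fin 2) ℂ) (α β : ℂ) : MvPolynomial (Fin 4) ℂ :=
  mobius m (F.poly α β)

/-- The complex projective line. -/
abbrev CP1 : Type := Projectivization ℂ (Fin 2 → ℂ)

/-- The point `(z : 1)` of the projective line. -/
def ofComplex (z : ℂ) : CP1 := Projectivization.mk ℂ ![z, 1] (by
  intro h
  simpa using congrFun h 1)

/-- The equation `p = 0` imposed on four points of the projective line. -/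
def Face (p : MvPolynomial (Fin 4) ℂ) (x u v y : CP1) : Prop :=
  homEval p (fun i => (![x, u, v, y] i).rep 0) (fun i => (![x, u, v, y] i).rep 1) = 0

/-- The equation `p(x, u, v, y) = 0` can be solved uniquely for its last argument, and the solution
is `y`. -/
def Gives (p : MvPolynomial (Fin 4) ℂ) (x u v y : CP1) : Prop :=
  ∀ t : CP1, Face p x u v t ↔ t = y

/-! ### The initial value problem on the rhombic dodecahedron

The rhombic dodecahedron has the 14 vertices
`x`; `x₁, x₂, x₃, x₄`; `x₁₂, x₂₃, x₃₄, x₄₁`; `x₄₁₂, x₁₂₃, x₂₃₄, x₃₄₁`; `x₁₂₃₄`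
and, for every cyclically consecutive quadruple `i, j, k, l` of indices, the faces
`(x, xᵢ, xⱼ, xᵢⱼ)`, `(xⱼ, xᵢⱼ, xⱼₖ, xᵢⱼₖ)` and `(xⱼₖ, xᵢⱼₖ, xⱼₖₗ, x₁₂₃₄)`, which makes 12 faces.
The edge from `x_I` to `x_{I ∪ {i}}` carries the parameter `αᵢ`. -/

/-- The value `y` of `x₁₂₃₄` is computed from the initial data through the face
`(xⱼₖ, xᵢⱼₖ, xⱼₖₗ, x₁₂₃₄)`, each step of the computation being uniquely solvable. Every vertex of this
face other than `x₁₂₃₄` is computed through the only chain of faces that leads to it. -/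
def WayThrough (Q : ℂ → ℂ → MvPolynomial (Fin 4) ℂ) (α : Fin 4 → ℂ) (x : CP1) (v : Fin 4 → CP1)
    (i j k l : Fin 4) (y : CP1) : Prop :=
  ∃ xij xjk xkl xijk xjkl : CP1,
    Gives (Q (α i) (α j)) x (v i) (v j) xij ∧
    Gives (Q (α j) (α k)) x (v j) (v k) xjk ∧
    Gives (Q (α k) (α l)) x (v k) (v l) xkl ∧
    Gives (Q (α i) (α k)) (v j) xij xjk xijk ∧
    Gives (Q (α j) (α l)) (v k) xjk xkl xjkl ∧
    Gives (Q (α i) (α l)) xjk xijk xjkl y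

/-- The four ways of computing `x₁₂₃₄`, numbered by `w : Fin 4`; the indices `i, j, k, l` are
cyclically consecutive, starting at `w` (addition in `Fin 4` is modulo `4`, and the indices
`1, 2, 3, 4` of the vertices and parameters are here `0, 1, 2, 3`). -/
def Way (Q : ℂ → ℂ → MvPolynomial (Fin 4) ℂ) (α : Fin 4 → ℂ) (x : CP1) (v : Fin 4 → CP1)
    (w : Fin 4) (y : CP1) : Prop :=
  WayThrough Q α x v w (w + 1) (w + 2) (w + 3) y

end ABS

end

/-! In homogeneous coordinates a face equation is a quadrilinear form, and its solution for the last
vertex is a vector `solve p X U V`, trilinear in the other three vertices. Each way around the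
dodecahedron thus becomes a vector that is polynomial in the initial data (`wayVec`), and two ways
agree when the wedge product of their vectors vanishes.

The dodecahedron uses 14 of the 16 vertices of a 4-cube; `x₁₃` and `x₂₄` are missing. What carries
the proof is the tetrahedron property (`TetrahedronLaws`): on an elementary cube the three
computations of `xᵢⱼₖ` give multiples of one vector that depends only on `xᵢ, xⱼ, xₖ`, and the
factors are edge biquadratics `h` up to constants. To compare the consecutive ways `i, j, k, l` and
`j, k, l, i`, the missing vertex `xᵢₖ` is restored. Then `xᵢⱼₖ, xⱼₖₗ, xₖₗᵢ` all lie on the cube with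
initial vertex `xₖ` and opposite vertex `x₁₂₃₄`, and the tetrahedron property of that cube makes the
two ways proportional (`wedge_wayVec`).

This argument cancels biquadratics, and comparing non-consecutive ways needs nonzero vectors in
between. Hence it is run over a polynomial ring, for generic data. Generic nonvanishing follows from
`edgeDisc_solve`, the composition law of the three quadratic forms attached to a 2×2×2 cube: it
carries nonvanishing discriminants from one edge to the next. The resulting polynomial identities
specialize to all complex data, and Möbius transformations only rescale the vectors.

It remains to verify the tetrahedron property for the nine canonical forms. For the rational and
exponential ones these are polynomial identities; `Q3`, `Q4` and `A2` share one computation based on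
two addition relations (`AdditionRelations`), which for `sn` come from product formulas for theta
functions. Irreducibility serves to exclude degenerate parameters, at which the bulk polynomial
splits into two bilinear factors. -/

noncomputable section

namespace ABS

/-! ### Multilinear evaluation of multiaffine polynomials -/

/-- A sum over the subsets of a four element set, written out. -/
theorem sum_finset_fin_four {M : Type*} [AddCommMonoid M] (f : Finset (Fin 4) → M) :
    ∑ S, f S = f ∅ + f {0} + f {1} + f {2} + f {3} + f {0, 1} + f {0, 2} + f {0, 3} + f {1, 2}
      + f {1, 3} + f {2, 3} + f {0, 1, 2} + f {0, 1, 3} + f {0, 2, 3} + f {1, 2, 3}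
      + f {0, 1, 2, 3} := by
  have h : (Finset.univ : Finset (Finset (Fin 4))) =
      {∅, {0}, {1}, {2}, {3}, {0, 1}, {0, 2}, {0, 3}, {1, 2}, {1, 3}, {2, 3}, {0, 1, 2},
        {0, 1, 3}, {0, 2, 3}, {1, 2, 3}, {0, 1, 2, 3}} := by decide
  rw [h]
  repeat rw [Finset.sum_insert (by decide)]
  rw [Finset.sum_singleton]
  simp only [add_assoc]

/-- The coefficient of the multiaffine monomial with the variables `S`. -/
def mcoeff (p : MvPolynomial (Fin 4) ℂ) (S : Finset (Fin 4)) : ℂ :=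
  p.coeff (∑ i ∈ S, Finsupp.single i 1)

section
variable {R : Type} [CommRing R] [Algebra ℂ R]

theorem homEval_expand (p : MvPolynomial (Fin 4) ℂ) (a b : Fin 4 → R) :
    homEval p a b =
      algebraMap ℂ R (mcoeff p ∅) * (b 0 * b 1 * b 2 * b 3)
      + algebraMap ℂ R (mcoeff p {0}) * (a 0 * b 1 * b 2 * b 3)
      + algebraMap ℂ R (mcoeff p {1}) * (b 0 * a 1 * b 2 * b 3)
      + algebraMap ℂ R (mcoeff p {2}) * (b 0 * b 1 * a 2 * b 3)
      + algebraMap ℂ R (mcoeff p {3}) * (b 0 * b 1 * b 2 * a 3)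
      + algebraMap ℂ R (mcoeff p {0, 1}) * (a 0 * a 1 * b 2 * b 3)
      + algebraMap ℂ R (mcoeff p {0, 2}) * (a 0 * b 1 * a 2 * b 3)
      + algebraMap ℂ R (mcoeff p {0, 3}) * (a 0 * b 1 * b 2 * a 3)
      + algebraMap ℂ R (mcoeff p {1, 2}) * (b 0 * a 1 * a 2 * b 3)
      + algebraMap ℂ R (mcoeff p {1, 3}) * (b 0 * a 1 * b 2 * a 3)
      + algebraMap ℂ R (mcoeff p {2, 3}) * (b 0 * b 1 * a 2 * a 3)
      + algebraMap ℂ R (mcoeff p {0, 1, 2}) * (a 0 * a 1 * a 2 * b 3)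
      + algebraMap ℂ R (mcoeff p {0, 1, 3}) * (a 0 * a 1 * b 2 * a 3)
      + algebraMap ℂ R (mcoeff p {0, 2, 3}) * (a 0 * b 1 * a 2 * a 3)
      + algebraMap ℂ R (mcoeff p {1, 2, 3}) * (b 0 * a 1 * a 2 * a 3)
      + algebraMap ℂ R (mcoeff p {0, 1, 2, 3}) * (a 0 * a 1 * a 2 * a 3) := by
  rw [homEval, sum_finset_fin_four]
  simp [Fin.prod_univ_four, mcoeff]

theorem homEval_add (p q : MvPolynomial (Fin 4) ℂ) (a b : Fin 4 → R) :
    homEval (p + q) a b = homEval p a b + homEval q a b := by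
  simp [homEval, add_mul, Finset.sum_add_distrib]

theorem homEval_C_mul (c : ℂ) (p : MvPolynomial (Fin 4) ℂ) (a b : Fin 4 → R) :
    homEval (MvPolynomial.C c * p) a b = algebraMap ℂ R c * homEval p a b := by
  simp [homEval, Finset.mul_sum, mul_assoc]

theorem homEval_sum {κ : Type*} (s : Finset κ) (f : κ → MvPolynomial (Fin 4) ℂ)
    (a b : Fin 4 → R) : homEval (∑ j ∈ s, f j) a b = ∑ j ∈ s, homEval (f j) a b := by
  simp only [homEval, MvPolynomial.coeff_sum, map_sum, Finset.sum_mul]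
  exact Finset.sum_comm

theorem sum_single_injective :
    Function.Injective fun S : Finset (Fin 4) => ∑ i ∈ S, Finsupp.single i (1 : ℕ) := by
  intro S T h
  ext i
  have := DFunLike.congr_fun h i
  simp only [Finsupp.finsetSum_apply, Finsupp.single_apply, Finset.sum_ite_eq'] at this
  by_cases hS : i ∈ S <;> by_cases hT : i ∈ T <;> simp_all

theorem homEval_prod_X (T : Finset (Fin 4)) (a b : Fin 4 → R) :
    homEval (∏ i ∈ T, MvPolynomial.X i) a b = ∏ i, if i ∈ T then a i else b i := by
  have h : (∏ i ∈ T, MvPolynomial.X i : MvPolynomial (Fin 4) ℂ)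
      = MvPolynomial.monomial (∑ i ∈ T, Finsupp.single i 1) 1 := by
    rw [MvPolynomial.monomial_sum_one]
    rfl
  simp only [h, homEval, MvPolynomial.coeff_monomial, sum_single_injective.eq_iff]
  rw [Finset.sum_eq_single T]
  · simp
  · intro S _ hS
    simp [hS.symm]
  · simp

/-- A product with one linear factor per variable is multiaffine, so reading off only the
multiaffine coefficients loses nothing and homogenization acts factor by factor. -/
theorem homEval_prod_linear (s t : Fin 4 → ℂ) (A B : Fin 4 → R) :
    homEval (∏ i, (MvPolynomial.C (s i) * MvPolynomial.X i + MvPolynomial.C (t i))) A B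
      = ∏ i, (algebraMap ℂ R (s i) * A i + algebraMap ℂ R (t i) * B i) := by
  rw [Finset.prod_add, Finset.prod_add, homEval_sum]
  refine Finset.sum_congr rfl fun S _ => ?_
  have : (∏ i ∈ S, MvPolynomial.C (s i) * MvPolynomial.X i)
      * ∏ i ∈ Finset.univ \ S, MvPolynomial.C (t i)
      = MvPolynomial.C ((∏ i ∈ S, s i) * ∏ i ∈ Finset.univ \ S, t i)
        * ∏ i ∈ S, (MvPolynomial.X i : MvPolynomial (Fin 4) ℂ) := by
    rw [Finset.prod_mul_distrib, map_mul, map_prod, map_prod]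
    ring
  rw [this, homEval_C_mul, homEval_prod_X, Finset.prod_mul_distrib, Finset.prod_mul_distrib,
    Finset.prod_ite, map_mul, map_prod, map_prod]
  have h1 : (Finset.univ.filter fun i => i ∈ S) = S := by ext; simp
  have h2 : (Finset.univ.filter fun i => i ∉ S) = Finset.univ \ S := by ext; simp
  rw [h1, h2]
  ring

end

/-! ### The quadrilinear form of a face -/

section
variable {R : Type} [CommRing R]

/-- The determinant of two vectors of the plane. -/
def wedge (A B : Fin 2 → R) : R := A 0 * B 1 - A 1 * B 0

theorem wedge_smul_left (c : R) (A B : Fin 2 → R) : wedge (c • A) B = c * wedge A B := by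
  simp only [wedge, Pi.smul_apply, smul_eq_mul]; ring

theorem wedge_smul_right (c : R) (A B : Fin 2 → R) : wedge A (c • B) = c * wedge A B := by
  simp only [wedge, Pi.smul_apply, smul_eq_mul]; ring

theorem wedge_self (A : Fin 2 → R) : wedge A A = 0 := by
  simp only [wedge]; ring

theorem vec_eq {R : Type} (U : Fin 2 → R) : U = ![U 0, U 1] := by
  ext i; fin_cases i <;> rfl

variable [Algebra ℂ R]

/-- The quadrilinear form in homogeneous coordinates that belongs to a multiaffine polynomial. -/
def face (p : MvPolynomial (Fin 4) ℂ) (X U V Y : Fin 2 → R) : R :=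
  homEval p ![X 0, U 0, V 0, Y 0] ![X 1, U 1, V 1, Y 1]

/-- The vector for which `face p X U V Y = wedge (solve p X U V) Y`: homogeneous coordinates of the
solution for the last argument. -/
def solve (p : MvPolynomial (Fin 4) ℂ) (X U V : Fin 2 → R) : Fin 2 → R :=
  ![face p X U V ![0, 1], -face p X U V ![1, 0]]

variable (p : MvPolynomial (Fin 4) ℂ)

theorem face_comb₁ (X U V Y : Fin 2 → R) :
    face p X U V Y = X 0 * face p ![1, 0] U V Y + X 1 * face p ![0, 1] U V Y := by
  simp only [face, homEval_expand, Matrix.cons_val]; ring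

theorem face_comb₂ (X U V Y : Fin 2 → R) :
    face p X U V Y = U 0 * face p X ![1, 0] V Y + U 1 * face p X ![0, 1] V Y := by
  simp only [face, homEval_expand, Matrix.cons_val]; ring

theorem face_comb₃ (X U V Y : Fin 2 → R) :
    face p X U V Y = V 0 * face p X U ![1, 0] Y + V 1 * face p X U ![0, 1] Y := by
  simp only [face, homEval_expand, Matrix.cons_val]; ring

theorem face_comb₄ (X U V Y : Fin 2 → R) :
    face p X U V Y = Y 0 * face p X U V ![1, 0] + Y 1 * face p X U V ![0, 1] := by
  simp only [face, homEval_expand, Matrix.cons_val]; ring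

theorem face_eq_wedge (X U V Y : Fin 2 → R) : face p X U V Y = wedge (solve p X U V) Y := by
  rw [face_comb₄]
  simp only [wedge, solve, Matrix.cons_val]; ring

theorem face_smul₁ (c : R) (X U V Y : Fin 2 → R) : face p (c • X) U V Y = c * face p X U V Y := by
  rw [face_comb₁, face_comb₁ p X]
  simp only [Pi.smul_apply, smul_eq_mul]; ring

theorem face_smul₂ (c : R) (X U V Y : Fin 2 → R) : face p X (c • U) V Y = c * face p X U V Y := by
  rw [face_comb₂, face_comb₂ p X U]
  simp only [Pi.smul_apply, smul_eq_mul]; ring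

theorem face_smul₃ (c : R) (X U V Y : Fin 2 → R) : face p X U (c • V) Y = c * face p X U V Y := by
  rw [face_comb₃, face_comb₃ p X U V]
  simp only [Pi.smul_apply, smul_eq_mul]; ring

theorem solve_smul₁ (c : R) (X U V : Fin 2 → R) : solve p (c • X) U V = c • solve p X U V := by
  simp [solve, face_smul₁]

theorem solve_smul₂ (c : R) (X U V : Fin 2 → R) : solve p X (c • U) V = c • solve p X U V := by
  simp [solve, face_smul₂]

theorem solve_smul₃ (c : R) (X U V : Fin 2 → R) : solve p X U (c • V) = c • solve p X U V := by
  simp [solve, face_smul₃]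

theorem solve_comb₃ (X U V : Fin 2 → R) :
    solve p X U V = V 0 • solve p X U ![1, 0] + V 1 • solve p X U ![0, 1] := by
  simp only [solve, face_comb₃ p X U V]
  ext i; fin_cases i
  · simp
  · simp; ring

/-- If the linear form `face p X U V` is a multiple of the linear form `T`, then the solutions are
proportional as well. -/
theorem solve_eq_of_face_eq {X U V : Fin 2 → R} {c : R} {T : (Fin 2 → R) → R}
    (h : ∀ Y, face p X U V Y = c * T Y) : solve p X U V = c • ![T ![0, 1], -T ![1, 0]] := by
  simp [solve, h]

/-- The discriminant with respect to the third and the fourth argument, a biquadratic form. -/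
def edgeDisc (X U : Fin 2 → R) : R :=
  face p X U ![1, 0] ![1, 0] * face p X U ![0, 1] ![0, 1]
    - face p X U ![1, 0] ![0, 1] * face p X U ![0, 1] ![1, 0]

/-- The discriminant with respect to the first and the fourth argument, a biquadratic form. -/
def diagDisc (U V : Fin 2 → R) : R :=
  face p ![1, 0] U V ![1, 0] * face p ![0, 1] U V ![0, 1]
    - face p ![1, 0] U V ![0, 1] * face p ![0, 1] U V ![1, 0]

theorem edgeDisc_smul₂ (c : R) (X U : Fin 2 → R) :
    edgeDisc p X (c • U) = c ^ 2 * edgeDisc p X U := by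
  simp only [edgeDisc, face_smul₂]; ring

theorem diagDisc_smul₁ (c : R) (X U : Fin 2 → R) :
    diagDisc p (c • X) U = c ^ 2 * diagDisc p X U := by
  simp only [diagDisc, face_smul₂]; ring

theorem diagDisc_smul₂ (c : R) (X U : Fin 2 → R) :
    diagDisc p X (c • U) = c ^ 2 * diagDisc p X U := by
  simp only [diagDisc, face_smul₃]; ring

/-- Cramer's rule for the linear map `V ↦ solve p X U V` of the plane, whose determinant is
`edgeDisc p X U`. -/
theorem wedge_solve_right (X U V : Fin 2 → R) :
    wedge (solve p X U V) (solve p X U ![0, 1]) = V 0 * edgeDisc p X U := by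
  rw [solve_comb₃]
  simp only [wedge, solve, edgeDisc, Matrix.cons_val, Pi.add_apply, Pi.smul_apply, smul_eq_mul]
  ring

theorem wedge_solve_left (X U V : Fin 2 → R) :
    wedge (solve p X U ![1, 0]) (solve p X U V) = V 1 * edgeDisc p X U := by
  rw [solve_comb₃ p X U V]
  simp only [wedge, solve, edgeDisc, Matrix.cons_val, Pi.add_apply, Pi.smul_apply, smul_eq_mul]
  ring

theorem solve_ne_zero [IsDomain R] {X U V : Fin 2 → R} (h : edgeDisc p X U ≠ 0) (hV : V ≠ 0) :
    solve p X U V ≠ 0 := by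
  intro h0
  have h1 := wedge_solve_right p X U V
  have h2 := wedge_solve_left p X U V
  simp only [h0, wedge, Pi.zero_apply, zero_mul, mul_zero, sub_zero, zero_eq_mul, h, or_false]
    at h1 h2
  exact hV (by rw [vec_eq V, h1, h2]; ext i; fin_cases i <;> rfl)

/-- Every vector is, up to the factor `edgeDisc p X U`, a value of `solve p X U`. -/
theorem exists_solve_eq (X U A : Fin 2 → R) : ∃ V, solve p X U V = edgeDisc p X U • A := by
  -- The adjugate of `V ↦ solve p X U V`, applied to `A`.
  refine ⟨![wedge A (solve p X U ![0, 1]), wedge (solve p X U ![1, 0]) A], ?_⟩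
  rw [solve_comb₃]
  ext i; fin_cases i
  · simp [wedge, solve, edgeDisc]; ring
  · simp [wedge, solve, edgeDisc]; ring

variable {R' : Type} [CommRing R'] [Algebra ℂ R'] (f : R →ₐ[ℂ] R')

theorem map_face (X U V Y : Fin 2 → R) :
    f (face p X U V Y) = face p (f ∘ X) (f ∘ U) (f ∘ V) (f ∘ Y) := by
  simp [face, homEval_expand]

theorem comp_solve (X U V : Fin 2 → R) :
    f ∘ solve p X U V = solve p (f ∘ X) (f ∘ U) (f ∘ V) := by
  have h0 : f ∘ ![(0 : R), 1] = ![0, 1] := by ext i; fin_cases i <;> simp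
  have h1 : f ∘ ![(1 : R), 0] = ![1, 0] := by ext i; fin_cases i <;> simp
  rw [vec_eq (f ∘ solve p X U V)]
  simp [solve, map_face, h0, h1]

theorem map_edgeDisc (X U : Fin 2 → R) :
    f (edgeDisc p X U) = edgeDisc p (f ∘ X) (f ∘ U) := by
  have h0 : f ∘ ![(0 : R), 1] = ![0, 1] := by ext i; fin_cases i <;> simp
  have h1 : f ∘ ![(1 : R), 0] = ![1, 0] := by ext i; fin_cases i <;> simp
  simp [edgeDisc, map_face, h0, h1]

theorem map_diagDisc (X U : Fin 2 → R) :
    f (diagDisc p X U) = diagDisc p (f ∘ X) (f ∘ U) := by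
  have h0 : f ∘ ![(0 : R), 1] = ![0, 1] := by ext i; fin_cases i <;> simp
  have h1 : f ∘ ![(1 : R), 0] = ![1, 0] := by ext i; fin_cases i <;> simp
  simp [diagDisc, map_face, h0, h1]

/-! ### Möbius transformations -/

/-- The action of a matrix on homogeneous coordinates. -/
def act (m : Matrix (Fin 2) (Fin 2) ℂ) (X : Fin 2 → R) : Fin 2 → R :=
  ![algebraMap ℂ R (m 0 0) * X 0 + algebraMap ℂ R (m 0 1) * X 1,
    algebraMap ℂ R (m 1 0) * X 0 + algebraMap ℂ R (m 1 1) * X 1]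

theorem homEval_mobius (m : GL (Fin 2) ℂ) (a b : Fin 4 → R) :
    homEval (mobius m p) a b
      = homEval p (fun i => algebraMap ℂ R (m.1 0 0) * a i + algebraMap ℂ R (m.1 0 1) * b i)
        (fun i => algebraMap ℂ R (m.1 1 0) * a i + algebraMap ℂ R (m.1 1 1) * b i) := by
  -- Each multiaffine monomial is turned into a product of one linear factor per variable, the shape
  -- that `homEval_prod_linear` can evaluate.
  have hm : mobius m p = ∑ S : Finset (Fin 4),
      MvPolynomial.C (p.coeff (∑ i ∈ S, Finsupp.single i 1)) *
        ∏ i, (MvPolynomial.C (if i ∈ S then m.1 0 0 else m.1 1 0) * MvPolynomial.X i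
          + MvPolynomial.C (if i ∈ S then m.1 0 1 else m.1 1 1)) := by
    rw [mobius, homEval]
    refine Finset.sum_congr rfl fun S _ => ?_
    rw [MvPolynomial.algebraMap_eq]
    refine congrArg _ (Finset.prod_congr rfl fun i _ => ?_)
    by_cases h : i ∈ S
    · simp only [if_pos h]
    · simp only [if_neg h]
  rw [hm, homEval_sum, homEval]
  refine Finset.sum_congr rfl fun S _ => ?_
  rw [homEval_C_mul, homEval_prod_linear]
  refine congrArg _ (Finset.prod_congr rfl fun i _ => ?_)
  by_cases h : i ∈ S
  · simp only [if_pos h]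
  · simp only [if_neg h]

theorem face_mobius (m : GL (Fin 2) ℂ) (X U V Y : Fin 2 → R) :
    face (mobius m p) X U V Y = face p (act m.1 X) (act m.1 U) (act m.1 V) (act m.1 Y) := by
  rw [face, homEval_mobius, face]
  congr 1 <;> ext i <;> fin_cases i <;> simp [act]

/-- The solution is a linear form in the last argument, made into a vector by means of `wedge`; as
`wedge` is multiplied by the determinant under `m`, the same factor appears here. -/
theorem act_solve_mobius (m : GL (Fin 2) ℂ) (X U V : Fin 2 → R) :
    act m.1 (solve (mobius m p) X U V)
      = algebraMap ℂ R m.1.det • solve p (act m.1 X) (act m.1 U) (act m.1 V) := by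
  rw [solve, face_mobius, face_mobius, face_comb₄, face_comb₄ p _ _ _ (act _ ![1, 0])]
  simp only [Matrix.det_fin_two, act, solve, map_sub, map_mul, Matrix.cons_val]
  ext i; fin_cases i
  · simp; ring
  · simp; ring

theorem wedge_act (m : Matrix (Fin 2) (Fin 2) ℂ) (X Y : Fin 2 → R) :
    wedge (act m X) (act m Y) = algebraMap ℂ R m.det * wedge X Y := by
  simp only [Matrix.det_fin_two, act, wedge, map_sub, map_mul, Matrix.cons_val]
  ring

end

/-! ### Ways around the rhombic dodecahedron in homogeneous coordinates -/

theorem wedge_eq_zero_iff {A B : Fin 2 → ℂ} (hA : A ≠ 0) :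
    wedge A B = 0 ↔ ∃ c : ℂ, c • A = B := by
  constructor
  · intro h
    rw [wedge] at h
    by_cases h0 : A 0 = 0
    · have h1 : A 1 ≠ 0 := fun h1 => hA (by rw [vec_eq A, h0, h1]; ext i; fin_cases i <;> rfl)
      refine ⟨B 1 / A 1, ?_⟩
      ext i; fin_cases i
      · simp only [h0, zero_mul, zero_sub, neg_eq_zero, mul_eq_zero, h1, false_or] at h
        simp [h0, h]
      · simp [h1]
    · refine ⟨B 0 / A 0, ?_⟩
      ext i; fin_cases i
      · simp [h0]
      · simp; field_simp; linear_combination -h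
  · rintro ⟨c, rfl⟩
    rw [wedge_smul_right, wedge_self, mul_zero]

theorem Face_iff (p : MvPolynomial (Fin 4) ℂ) (x u v y : CP1) :
    Face p x u v y ↔ face p x.rep u.rep v.rep y.rep = 0 := by
  have h : ∀ k : Fin 2, (fun i => (![x, u, v, y] i).rep k)
      = ![x.rep k, u.rep k, v.rep k, y.rep k] := by
    intro k; ext i; fin_cases i <;> rfl
  rw [Face, h, h, face]

/-- Unique solvability forces the solution vector to be nonzero: otherwise every point would solve
the equation, and the projective line has more than one point. -/
theorem Gives.exists_rep_eq {p : MvPolynomial (Fin 4) ℂ} {x u v y : CP1} (h : Gives p x u v y) :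
    ∃ c : ℂ, c ≠ 0 ∧ c • y.rep = solve p x.rep u.rep v.rep := by
  have h0 : solve p x.rep u.rep v.rep ≠ 0 := by
    intro h0
    have key : ∀ t : CP1, t = y := fun t => by
      rw [← h t, Face_iff, face_eq_wedge, h0]
      simp [wedge]
    have h1 := (key (ofComplex 0)).trans (key (ofComplex 1)).symm
    rw [ofComplex, ofComplex, Projectivization.mk_eq_mk_iff'] at h1
    obtain ⟨a, ha⟩ := h1
    have := congrFun ha 0
    have := congrFun ha 1
    simp_all
  have h1 := (h y).2 rfl
  rw [Face_iff, face_eq_wedge, wedge_eq_zero_iff h0] at h1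
  obtain ⟨c, hc⟩ := h1
  have hc0 : c ≠ 0 := by
    rintro rfl
    exact y.rep_nonzero (by rw [← hc, zero_smul])
  exact ⟨c⁻¹, inv_ne_zero hc0, by rw [← hc, smul_smul, inv_mul_cancel₀ hc0, one_smul]⟩

theorem gives_mk {p : MvPolynomial (Fin 4) ℂ} {X U V : Fin 2 → ℂ} (hX : X ≠ 0) (hU : U ≠ 0)
    (hV : V ≠ 0) (h : solve p X U V ≠ 0) :
    Gives p (.mk ℂ X hX) (.mk ℂ U hU) (.mk ℂ V hV) (.mk ℂ (solve p X U V) h) := by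
  intro t
  obtain ⟨a, ha⟩ := Projectivization.exists_smul_eq_mk_rep ℂ X hX
  obtain ⟨b, hb⟩ := Projectivization.exists_smul_eq_mk_rep ℂ U hU
  obtain ⟨c, hc⟩ := Projectivization.exists_smul_eq_mk_rep ℂ V hV
  rw [Face_iff, ← ha, ← hb, ← hc, face_eq_wedge]
  simp only [Units.smul_def, solve_smul₁, solve_smul₂, solve_smul₃, wedge_smul_left, mul_eq_zero,
    Units.ne_zero, false_or]
  rw [wedge_eq_zero_iff h]
  conv_rhs => rw [← t.mk_rep, Projectivization.mk_eq_mk_iff']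

section
variable {R : Type} [CommRing R] [Algebra ℂ R]
variable {ι : Type} (p : ι → ι → MvPolynomial (Fin 4) ℂ)

/-- Homogeneous coordinates of `x₁₂₃₄`, computed from homogeneous coordinates of the initial data
through the face `(xⱼₖ, xᵢⱼₖ, xⱼₖₗ, x₁₂₃₄)`. -/
def wayVec (X : Fin 2 → R) (v : ι → Fin 2 → R) (i j k l : ι) : Fin 2 → R :=
  solve (p i l) (solve (p j k) X (v j) (v k))
    (solve (p i k) (v j) (solve (p i j) X (v i) (v j)) (solve (p j k) X (v j) (v k)))
    (solve (p j l) (v k) (solve (p j k) X (v j) (v k)) (solve (p k l) X (v k) (v l)))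

theorem comp_wayVec {R' : Type} [CommRing R'] [Algebra ℂ R'] (f : R →ₐ[ℂ] R') (X : Fin 2 → R)
    (v : ι → Fin 2 → R) (i j k l : ι) :
    f ∘ wayVec p X v i j k l = wayVec p (f ∘ X) (fun n => f ∘ v n) i j k l := by
  simp only [wayVec, comp_solve]

theorem wayVec_smul (X : Fin 2 → ℂ) (v : ι → Fin 2 → ℂ) (a : ℂ) (b : ι → ℂ) (ha : a ≠ 0)
    (hb : ∀ n, b n ≠ 0) (i j k l : ι) :
    ∃ c : ℂ, c ≠ 0 ∧ wayVec p (a • X) (fun n => b n • v n) i j k l = c • wayVec p X v i j k l := by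
  simp only [wayVec, solve_smul₁, solve_smul₂, solve_smul₃, smul_smul]
  exact ⟨_, by simp [ha, hb], rfl⟩

theorem act_wayVec_mobius (m : GL (Fin 2) ℂ) (X : Fin 2 → ℂ) (v : ι → Fin 2 → ℂ) (i j k l : ι) :
    ∃ c : ℂ, c ≠ 0 ∧ act m.1 (wayVec (fun i j => mobius m (p i j)) X v i j k l)
      = c • wayVec p (act m.1 X) (fun n => act m.1 (v n)) i j k l := by
  have hm : m.1.det ≠ 0 := m.isUnit.map Matrix.detMonoidHom |>.ne_zero
  simp only [wayVec, act_solve_mobius, solve_smul₁, solve_smul₂, solve_smul₃, smul_smul]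
  exact ⟨_, by simp [hm], rfl⟩

end

theorem WayThrough.exists_rep_eq {Q : ℂ → ℂ → MvPolynomial (Fin 4) ℂ} {α : Fin 4 → ℂ} {x : CP1}
    {v : Fin 4 → CP1} {i j k l : Fin 4} {y : CP1} (h : WayThrough Q α x v i j k l y) :
    ∃ c : ℂ, c ≠ 0 ∧ c • y.rep
      = wayVec (fun i j => Q (α i) (α j)) x.rep (fun n => (v n).rep) i j k l := by
  obtain ⟨xij, xjk, xkl, xijk, xjkl, h1, h2, h3, h4, h5, h6⟩ := h
  obtain ⟨c1, hc1, e1⟩ := h1.exists_rep_eq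
  obtain ⟨c2, hc2, e2⟩ := h2.exists_rep_eq
  obtain ⟨c3, hc3, e3⟩ := h3.exists_rep_eq
  obtain ⟨c4, hc4, e4⟩ := h4.exists_rep_eq
  obtain ⟨c5, hc5, e5⟩ := h5.exists_rep_eq
  obtain ⟨c6, hc6, e6⟩ := h6.exists_rep_eq
  simp only [wayVec, ← e1, ← e2, ← e3, solve_smul₁, solve_smul₂, solve_smul₃, ← e4, ← e5, ← e6,
    smul_smul]
  exact ⟨_, by simp [*], rfl⟩

theorem solve_zero₁ {R : Type} [CommRing R] [Algebra ℂ R] (p : MvPolynomial (Fin 4) ℂ)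
    (U V : Fin 2 → R) : solve p 0 U V = 0 := by
  simpa using solve_smul₁ p 0 0 U V

theorem solve_zero₂ {R : Type} [CommRing R] [Algebra ℂ R] (p : MvPolynomial (Fin 4) ℂ)
    (X V : Fin 2 → R) : solve p X 0 V = 0 := by
  simpa using solve_smul₂ p 0 X 0 V

theorem solve_zero₃ {R : Type} [CommRing R] [Algebra ℂ R] (p : MvPolynomial (Fin 4) ℂ)
    (X U : Fin 2 → R) : solve p X U 0 = 0 := by
  simpa using solve_smul₃ p 0 X U 0

/-- Since `solve` vanishes as soon as one argument does, a nonzero final vector forces all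
intermediate vectors to be nonzero. Solvability of a whole way is thus a condition on its last
vector alone. -/
theorem wayThrough_mk {Q : ℂ → ℂ → MvPolynomial (Fin 4) ℂ} {α : Fin 4 → ℂ} {X : Fin 2 → ℂ}
    {v : Fin 4 → Fin 2 → ℂ} (hX : X ≠ 0) (hv : ∀ n, v n ≠ 0) {i j k l : Fin 4}
    (h : wayVec (fun i j => Q (α i) (α j)) X v i j k l ≠ 0) :
    WayThrough Q α (.mk ℂ X hX) (fun n => .mk ℂ (v n) (hv n)) i j k l (.mk ℂ _ h) := by
  have hjk : solve (Q (α j) (α k)) X (v j) (v k) ≠ 0 := fun h0 =>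
    h (by rw [wayVec, h0, solve_zero₁])
  have hijk : solve (Q (α i) (α k)) (v j) (solve (Q (α i) (α j)) X (v i) (v j))
      (solve (Q (α j) (α k)) X (v j) (v k)) ≠ 0 := fun h0 => h (by rw [wayVec, h0, solve_zero₂])
  have hjkl : solve (Q (α j) (α l)) (v k) (solve (Q (α j) (α k)) X (v j) (v k))
      (solve (Q (α k) (α l)) X (v k) (v l)) ≠ 0 := fun h0 => h (by rw [wayVec, h0, solve_zero₃])
  have hij : solve (Q (α i) (α j)) X (v i) (v j) ≠ 0 := fun h0 => hijk (by rw [h0, solve_zero₂])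
  have hkl : solve (Q (α k) (α l)) X (v k) (v l) ≠ 0 := fun h0 => hjkl (by rw [h0, solve_zero₃])
  exact ⟨.mk ℂ _ hij, .mk ℂ _ hjk, .mk ℂ _ hkl, .mk ℂ _ hijk, .mk ℂ _ hjkl, gives_mk _ _ _ _,
    gives_mk _ _ _ _, gives_mk _ _ _ _, gives_mk _ _ _ _, gives_mk _ _ _ _, gives_mk _ _ _ _⟩

/-! ### The tetrahedron property and its consequences -/

/-- A family of face equations with the tetrahedron property: the discriminant of a face along an
edge depends only on the edge, and around an elementary cube the value at the vertex opposite to the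
initial one is given by a multiaffine relation `T` between the vertices of a tetrahedron. -/
structure TetrahedronLaws {R : Type} [CommRing R] [Algebra ℂ R] {ι : Type}
    (p : ι → ι → MvPolynomial (Fin 4) ℂ) (h : ι → (Fin 2 → R) → (Fin 2 → R) → R)
    (T : ι → ι → ι → (Fin 2 → R) → (Fin 2 → R) → (Fin 2 → R) → (Fin 2 → R) → R) : Prop where
  swap : ∀ i j, i ≠ j → ∀ X U V Y : Fin 2 → R, face (p j i) X V U Y = -face (p i j) X U V Y
  symm : ∀ i j, i ≠ j → ∀ X U V Y : Fin 2 → R, face (p i j) U X Y V = face (p i j) X U V Y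
  edge : ∀ i j, i ≠ j → ∃ c : ℂ, c ≠ 0 ∧ ∀ X U : Fin 2 → R,
    edgeDisc (p i j) X U = algebraMap ℂ R c * h i X U
  swap₁₂ : ∀ i j k, i ≠ j → i ≠ k → j ≠ k → ∀ U V Z Y, T j i k V U Z Y = -T i j k U V Z Y
  swap₂₃ : ∀ i j k, i ≠ j → i ≠ k → j ≠ k → ∀ U V Z Y, T i k j U Z V Y = -T i j k U V Z Y
  tetra : ∀ i j k, i ≠ j → i ≠ k → j ≠ k →
    ∃ c : ℂ, c ≠ 0 ∧ ∀ X U V Z Y : Fin 2 → R,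
      face (p j k) U (solve (p i j) X U V) (solve (p i k) X U Z) Y
        = algebraMap ℂ R c * h i X U * T i j k U V Z Y

section
variable {R : Type} [CommRing R] [Algebra ℂ R]

theorem solve_neg₂ (p : MvPolynomial (Fin 4) ℂ) (X U V : Fin 2 → R) :
    solve p X (-U) V = -solve p X U V := by
  simpa using solve_smul₂ p (-1) X U V

theorem solve_neg₃ (p : MvPolynomial (Fin 4) ℂ) (X U V : Fin 2 → R) :
    solve p X U (-V) = -solve p X U V := by
  simpa using solve_smul₃ p (-1) X U V

theorem edgeDisc_neg₂ (p : MvPolynomial (Fin 4) ℂ) (X U : Fin 2 → R) :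
    edgeDisc p X (-U) = edgeDisc p X U := by
  simpa using edgeDisc_smul₂ p (-1) X U

variable {ι : Type} {p : ι → ι → MvPolynomial (Fin 4) ℂ} {h : ι → (Fin 2 → R) → (Fin 2 → R) → R}
  {T : ι → ι → ι → (Fin 2 → R) → (Fin 2 → R) → (Fin 2 → R) → (Fin 2 → R) → R}

/-- The solution of the tetrahedron relation for its last argument. -/
def tetVec (T : ι → ι → ι → (Fin 2 → R) → (Fin 2 → R) → (Fin 2 → R) → (Fin 2 → R) → R)
    (i j k : ι) (U V Z : Fin 2 → R) : Fin 2 → R :=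
  ![T i j k U V Z ![0, 1], -T i j k U V Z ![1, 0]]

namespace TetrahedronLaws

variable (hL : TetrahedronLaws p h T)
include hL

theorem solve_swap {i j : ι} (hij : i ≠ j) (X U V : Fin 2 → R) :
    solve (p j i) X V U = -solve (p i j) X U V := by
  simp [solve, hL.swap i j hij]

theorem tetVec_swap₁₂ {i j k : ι} (hij : i ≠ j) (hik : i ≠ k) (hjk : j ≠ k) (U V Z : Fin 2 → R) :
    tetVec T j i k V U Z = -tetVec T i j k U V Z := by
  simp [tetVec, hL.swap₁₂ i j k hij hik hjk]

theorem tetVec_swap₂₃ {i j k : ι} (hij : i ≠ j) (hik : i ≠ k) (hjk : j ≠ k) (U V Z : Fin 2 → R) :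
    tetVec T i k j U Z V = -tetVec T i j k U V Z := by
  simp [tetVec, hL.swap₂₃ i j k hij hik hjk]

/-- The tetrahedron property in vector form, through the face at `xᵢ`. The next two lemmas treat the
faces at `xⱼ` and `xₖ` by relabelling; all three yield multiples of the same `tetVec`. -/
theorem solve_first {i j k : ι} (hij : i ≠ j) (hik : i ≠ k) (hjk : j ≠ k) :
    ∃ c : ℂ, c ≠ 0 ∧ ∀ X U V Z : Fin 2 → R,
      solve (p j k) U (solve (p i j) X U V) (solve (p i k) X U Z)
      = (algebraMap ℂ R c * h i X U) • tetVec T i j k U V Z := by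
  obtain ⟨c, hc0, hc⟩ := hL.tetra i j k hij hik hjk
  exact ⟨c, hc0, fun X U V Z => solve_eq_of_face_eq _ (hc X U V Z)⟩

theorem solve_middle {i j k : ι} (hij : i ≠ j) (hik : i ≠ k) (hjk : j ≠ k) :
    ∃ c : ℂ, c ≠ 0 ∧ ∀ X U V Z : Fin 2 → R,
      solve (p i k) V (solve (p i j) X U V) (solve (p j k) X V Z)
      = (algebraMap ℂ R c * h j X V) • tetVec T i j k U V Z := by
  obtain ⟨c, hc0, hc⟩ := hL.solve_first hij.symm hjk hik
  refine ⟨c, hc0, fun X U V Z => ?_⟩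
  rw [hL.solve_swap hij.symm, solve_neg₂, hc, hL.tetVec_swap₁₂ hij hik hjk, smul_neg, neg_neg]

theorem solve_last {i j k : ι} (hij : i ≠ j) (hik : i ≠ k) (hjk : j ≠ k) :
    ∃ c : ℂ, c ≠ 0 ∧ ∀ X U V Z : Fin 2 → R,
      solve (p i j) Z (solve (p i k) X U Z) (solve (p j k) X V Z)
      = (algebraMap ℂ R c * h k X Z) • tetVec T i j k U V Z := by
  obtain ⟨c, hc0, hc⟩ := hL.solve_first hik.symm hjk.symm hij
  refine ⟨c, hc0, fun X U V Z => ?_⟩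
  rw [hL.solve_swap hik.symm, hL.solve_swap hjk.symm, solve_neg₂, solve_neg₃, neg_neg, hc,
    hL.tetVec_swap₁₂ hik hij hjk.symm, hL.tetVec_swap₂₃ hij hik hjk, neg_neg]

/-- Two consecutive ways around the rhombic dodecahedron lead to proportional vectors. -/
theorem wedge_wayVec [IsDomain R] {i j k l : ι} (hij : i ≠ j) (hik : i ≠ k) (hil : i ≠ l)
    (hjk : j ≠ k) (hjl : j ≠ l) (hkl : k ≠ l) (X : Fin 2 → R) (v : ι → Fin 2 → R)
    (hk : h k X (v k) ≠ 0) :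
    wedge (wayVec p X v i j k l) (wayVec p X v j k l i) = 0 := by
  obtain ⟨c1, n1, h1⟩ := hL.solve_middle hij hik hjk
  obtain ⟨c2, n2, h2⟩ := hL.solve_middle hjk hjl hkl
  obtain ⟨c3, n3, h3⟩ := hL.solve_last hij hik hjk
  obtain ⟨c4, n4, h4⟩ := hL.solve_middle hij hil hjl
  obtain ⟨c5, n5, h5⟩ := hL.solve_middle hkl hik.symm hil.symm
  obtain ⟨c6, n6, h6⟩ := hL.solve_first hkl hik.symm hil.symm
  obtain ⟨c7, n7, h7⟩ := hL.solve_middle hjl hij.symm hil.symm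
  set A := solve (p j k) X (v j) (v k) with hA
  set D := solve (p k l) X (v k) (v l) with hD
  -- `B` is the auxiliary vertex `xᵢₖ`, used by neither way. `B`, `A`, `D` are the neighbours of
  -- `xₖ` in the directions `i`, `j`, `l`.
  set B := solve (p i k) X (v i) (v k) with hB
  have hB' : solve (p k i) X (v k) (v i) = -B := hL.solve_swap hik X (v i) (v k)
  -- On the cube based at `xₖ`, the vertex `x₁₂₃₄` computed through the face at `A` is a multiple of
  -- the tetrahedron vector of `B, A, D`. By `h3` and `h2` the other two vertices of that face are
  -- multiples of `xᵢⱼₖ` and `xⱼₖₗ` from the first way.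
  have e1 := h4 (v k) B A D
  rw [h3 X (v i) (v j) (v k), h2 X (v j) (v k) (v l), solve_smul₂, solve_smul₃] at e1
  -- The same cube through the face at `D`, which is the last face of the second way. After
  -- reordering the indices, the tetrahedron vector is the one of `e1`.
  have e2 := h7 (v k) A D B
  have e6 := h6 X (v k) (v l) (v i)
  rw [hB', solve_neg₃, neg_eq_iff_eq_neg, ← neg_smul] at e6
  rw [e6, h2 X (v j) (v k) (v l), solve_smul₂, solve_smul₃,
    hL.tetVec_swap₂₃ hij.symm hjl hil, hL.tetVec_swap₁₂ hij hil hjl, neg_neg] at e2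
  have e3 : wayVec p X v i j k l = (algebraMap ℂ R c1 * h j X (v j)) •
      (algebraMap ℂ R c2 * h k X (v k)) •
        solve (p i l) A (tetVec T i j k (v i) (v j) (v k)) (tetVec T j k l (v j) (v k) (v l)) := by
    rw [wayVec, h1 X (v i) (v j) (v k), h2 X (v j) (v k) (v l), solve_smul₂, solve_smul₃]
  have e4 : wayVec p X v j k l i = (algebraMap ℂ R c2 * h k X (v k)) •
      (algebraMap ℂ R c5 * h l X (v l)) •
        solve (p j i) D (tetVec T j k l (v j) (v k) (v l)) (tetVec T k l i (v k) (v l) (v i)) := by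
    rw [wayVec, h2 X (v j) (v k) (v l), h5 X (v k) (v l) (v i), solve_smul₂, solve_smul₃]
  set S1 := solve (p i l) A (tetVec T i j k (v i) (v j) (v k)) (tetVec T j k l (v j) (v k) (v l))
  set S2 := solve (p j i) D (tetVec T j k l (v j) (v k) (v l)) (tetVec T k l i (v k) (v l) (v i))
  have n : ∀ c : ℂ, c ≠ 0 → algebraMap ℂ R c ≠ 0 := fun c hc => by
    rwa [Ne, map_eq_zero_iff _ (algebraMap ℂ R).injective]
  -- Both final faces are proportional to one vector, so their wedge product vanishes up to a
  -- constant times `h k X (v k) ^ 4`, which is then cancelled.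
  have e5 : (algebraMap ℂ R c3 * h k X (v k)) * (algebraMap ℂ R c2 * h k X (v k)) *
      ((algebraMap ℂ R c2 * h k X (v k)) * -(algebraMap ℂ R c6 * h k X (v k))) * wedge S1 S2 = 0 := by
    have := congrArg₂ wedge e1 e2
    simp only [wedge_smul_left, wedge_smul_right, wedge_self, mul_zero] at this
    linear_combination this
  have e6 : wedge S1 S2 = 0 := by
    simpa [hk, n _ n2, n _ n3, n _ n6] using e5
  rw [e3, e4]
  simp only [wedge_smul_left, wedge_smul_right, e6, mul_zero]

theorem face_transpose {i j : ι} (hij : i ≠ j) (X U V Y : Fin 2 → R) :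
    face (p i j) X U V Y = -face (p j i) U Y X V := by
  rw [← hL.symm i j hij, ← hL.swap j i hij.symm]

/-- The composition law of the three discriminants of a trilinear form. -/
theorem edgeDisc_solve {i j : ι} (hij : i ≠ j) (X U V : Fin 2 → R) :
    edgeDisc (p j i) U (solve (p i j) X U V)
      = -(edgeDisc (p i j) X U * diagDisc (p i j) U V) := by
  -- With `U` fixed, only a trilinear form in `X, V, Y` remains. The left side is its discriminant
  -- in `X, V` at the solution `Y`; the right side multiplies the discriminants in `V, Y` and in `X,
  -- Y`.
  have h1 : ∀ a b Y : Fin 2 → R, face (p j i) U Y a b = -face (p i j) a U b Y := fun a b Y => by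
    rw [hL.face_transpose hij, neg_neg]
  simp only [edgeDisc, diagDisc, h1]
  rw [face_comb₄ _ _ _ _ (solve _ _ _ _), face_comb₄ _ _ _ _ (solve _ _ _ _),
    face_comb₄ _ _ _ _ (solve _ _ _ _), face_comb₄ _ _ _ _ (solve _ _ _ _)]
  simp only [solve, Matrix.cons_val]
  rw [face_comb₁ (p i j) X U V ![0, 1], face_comb₁ (p i j) X U V ![1, 0],
    face_comb₁ (p i j) X U ![1, 0] ![1, 0], face_comb₁ (p i j) X U ![0, 1] ![1, 0],
    face_comb₁ (p i j) X U ![1, 0] ![0, 1], face_comb₁ (p i j) X U ![0, 1] ![0, 1],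
    face_comb₃ (p i j) ![1, 0] U V ![1, 0], face_comb₃ (p i j) ![0, 1] U V ![1, 0],
    face_comb₃ (p i j) ![1, 0] U V ![0, 1], face_comb₃ (p i j) ![0, 1] U V ![0, 1]]
  ring

variable [IsDomain R]

/-- Both discriminants are nonzero constants times `h i X U`, so nonvanishing on an edge passes from
one face to any other containing it. -/
theorem edgeDisc_ne_zero {i j k : ι} (hij : i ≠ j) (hik : i ≠ k) {X U : Fin 2 → R}
    (h0 : edgeDisc (p i j) X U ≠ 0) : edgeDisc (p i k) X U ≠ 0 := by
  obtain ⟨c, _, hc⟩ := hL.edge i j hij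
  obtain ⟨d, hd, hd'⟩ := hL.edge i k hik
  rw [hc] at h0
  rw [hd']
  refine mul_ne_zero ?_ (right_ne_zero_of_mul h0)
  rwa [Ne, map_eq_zero_iff _ (algebraMap ℂ R).injective]

/-- `edgeDisc_solve` moves nonvanishing discriminants to the edges from `xⱼ` and `xₖ` to `xⱼₖ`, then
to the edge from `xⱼₖ` to `xⱼₖₗ`. Over such edges `solve` is injective in the remaining argument, so
`xᵢⱼ`, `xᵢⱼₖ` and `x₁₂₃₄` are successively nonzero. -/
theorem wayVec_ne_zero {i j k l : ι} (hij : i ≠ j) (hik : i ≠ k) (hil : i ≠ l)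
    (hjk : j ≠ k) (hjl : j ≠ l) {X : Fin 2 → R} {v : ι → Fin 2 → R}
    (hi : v i ≠ 0) (hX : edgeDisc (p j k) X (v j) ≠ 0) (hX' : edgeDisc (p k j) X (v k) ≠ 0)
    (hd : diagDisc (p j k) (v j) (v k) ≠ 0) (hd' : diagDisc (p k j) (v k) (v j) ≠ 0)
    (hd'' : diagDisc (p j l) (solve (p j k) X (v j) (v k)) (solve (p k l) X (v k) (v l)) ≠ 0) :
    wayVec p X v i j k l ≠ 0 := by
  have h1 : edgeDisc (p k j) (v j) (solve (p j k) X (v j) (v k)) ≠ 0 := by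
    rw [hL.edgeDisc_solve hjk, neg_ne_zero]
    exact mul_ne_zero hX hd
  have h2 : edgeDisc (p j k) (v k) (solve (p j k) X (v j) (v k)) ≠ 0 := by
    rw [hL.solve_swap hjk.symm, edgeDisc_neg₂, hL.edgeDisc_solve hjk.symm, neg_ne_zero]
    exact mul_ne_zero hX' hd'
  have h3 : edgeDisc (p l j) (solve (p j k) X (v j) (v k))
      (solve (p j l) (v k) (solve (p j k) X (v j) (v k)) (solve (p k l) X (v k) (v l))) ≠ 0 := by
    rw [hL.edgeDisc_solve hjl, neg_ne_zero]
    exact mul_ne_zero (hL.edgeDisc_ne_zero hjk hjl h2) hd''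
  have h4 : solve (p i j) X (v i) (v j) ≠ 0 := by
    rw [hL.solve_swap hij.symm, neg_ne_zero]
    exact solve_ne_zero _ (hL.edgeDisc_ne_zero hjk hij.symm hX) hi
  have h5 : solve (p i k) (v j) (solve (p i j) X (v i) (v j)) (solve (p j k) X (v j) (v k)) ≠ 0 := by
    rw [hL.solve_swap hik.symm, neg_ne_zero]
    exact solve_ne_zero _ (hL.edgeDisc_ne_zero hjk.symm hik.symm h1) h4
  rw [wayVec, hL.solve_swap hil.symm, neg_ne_zero]
  exact solve_ne_zero _ (hL.edgeDisc_ne_zero hjl.symm hil.symm h3) h5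

end TetrahedronLaws
end

/-! ### Consistency for generic and for arbitrary initial data -/

theorem wedge_trans {R : Type} [CommRing R] [IsDomain R] {A B C : Fin 2 → R} (hB : B ≠ 0)
    (h1 : wedge A B = 0) (h2 : wedge B C = 0) : wedge A C = 0 := by
  by_contra h
  refine hB (funext fun i => ?_)
  -- The linear relation between any three vectors of the plane.
  have h3 : wedge A C * B i = wedge B C * A i + wedge A B * C i := by
    fin_cases i
    · simp [wedge]; ring
    · simp [wedge]; ring
  rw [h1, h2, zero_mul, zero_mul, add_zero] at h3
  exact (mul_eq_zero.1 h3).resolve_left h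

theorem act_inv (m : GL (Fin 2) ℂ) (X : Fin 2 → ℂ) : act m.1 (act (m⁻¹).1 X) = X := by
  have h : m.1 * (m⁻¹).1 = 1 := by rw [← Units.val_mul, mul_inv_cancel, Units.val_one]
  have h' : ∀ i j, m.1 i 0 * (m⁻¹).1 0 j + m.1 i 1 * (m⁻¹).1 1 j = (1 : Matrix _ _ ℂ) i j :=
    fun i j => by rw [← h, Matrix.mul_apply, Fin.sum_univ_two]
  have h00 := h' 0 0
  have h01 := h' 0 1
  have h10 := h' 1 0
  have h11 := h' 1 1
  simp only [Matrix.one_apply_eq, Matrix.one_apply_ne (zero_ne_one : (0 : Fin 2) ≠ 1),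
    Matrix.one_apply_ne (one_ne_zero : (1 : Fin 2) ≠ 0)] at h00 h01 h10 h11
  ext i; fin_cases i
  · simp [act, -Matrix.coe_units_inv]; linear_combination X 0 * h00 + X 1 * h01
  · simp [act, -Matrix.coe_units_inv]; linear_combination X 0 * h10 + X 1 * h11

/-- The coordinate ring of the space of homogeneous coordinates of the initial data. -/
abbrev InitRing : Type := MvPolynomial (Option (Fin 4) × Fin 2) ℂ

/-- Generic homogeneous coordinates of the initial data. -/
def gen (n : Option (Fin 4)) : Fin 2 → InitRing := fun a => MvPolynomial.X (n, a)

/-- Evaluation at given homogeneous coordinates of the initial data. -/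
def evalInit (d : Option (Fin 4) → Fin 2 → ℂ) : InitRing →ₐ[ℂ] ℂ :=
  MvPolynomial.aeval fun q => d q.1 q.2

theorem evalInit_comp_gen (d : Option (Fin 4) → Fin 2 → ℂ) (n : Option (Fin 4)) :
    evalInit d ∘ gen n = d n := by
  ext a
  simp [evalInit, gen]

theorem exists_evalInit_ne_zero {G : InitRing} (hG : G ≠ 0) : ∃ d, evalInit d G ≠ 0 := by
  by_contra! h
  refine hG (MvPolynomial.funext fun e => ?_)
  have := h fun n a => e (n, a)
  rw [evalInit, MvPolynomial.aeval_eq_eval] at this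
  simpa using this

theorem ne_zero_of_map {R R' : Type} [CommRing R] [CommRing R'] [Algebra ℂ R] [Algebra ℂ R']
    (f : R →ₐ[ℂ] R') {a : R} (h : f a ≠ 0) : a ≠ 0 := by
  rintro rfl
  exact h (map_zero f)

section
variable (p : Fin 4 → Fin 4 → MvPolynomial (Fin 4) ℂ)

/-- The vector computed along the way with the number `w`. -/
def way {R : Type} [CommRing R] [Algebra ℂ R] (d : Option (Fin 4) → Fin 2 → R) (w : Fin 4) :
    Fin 2 → R :=
  wayVec p (d none) (fun n => d (some n)) w (w + 1) (w + 2) (w + 3)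

theorem comp_way {R R' : Type} [CommRing R] [CommRing R'] [Algebra ℂ R] [Algebra ℂ R']
    (f : R →ₐ[ℂ] R') (d : Option (Fin 4) → Fin 2 → R) (w : Fin 4) :
    f ∘ way p d w = way p (fun n => f ∘ d n) w := comp_wayVec p f _ _ _ _ _ _

theorem comp_way_gen (d : Option (Fin 4) → Fin 2 → ℂ) (w : Fin 4) :
    evalInit d ∘ way p gen w = way p d w := by
  simp only [comp_way, evalInit_comp_gen]

/-- A way that can be carried out for some initial data can be carried out for generic complex
initial data. -/
theorem exists_polynomial {e : Option (Fin 4) → Fin 2 → ℂ} {w : Fin 4} (he : way p e w ≠ 0) :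
    ∃ P : MvPolynomial (Fin 5) ℂ, P ≠ 0 ∧ ∀ d : Fin 5 → ℂ, MvPolynomial.eval d P ≠ 0 →
      wayVec p ![d 0, 1] (fun n => ![d n.succ, 1]) w (w + 1) (w + 2) (w + 3) ≠ 0 := by
  obtain ⟨a, ha⟩ := Function.ne_iff.1 he
  have h1 : way p gen w a ≠ 0 := by
    refine ne_zero_of_map (evalInit e) ?_
    rw [← comp_way_gen] at ha
    exact ha
  -- The extra factors provide a point at which all initial values are finite, so that the data can
  -- be dehomogenized.
  have h2 : way p gen w a * ∏ n, gen n 1 ≠ 0 :=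
    mul_ne_zero h1 (Finset.prod_ne_zero_iff.2 fun n _ => MvPolynomial.X_ne_zero _)
  obtain ⟨d, hd⟩ := exists_evalInit_ne_zero h2
  rw [map_mul, map_prod] at hd
  have hd1 : way p d w a ≠ 0 := by
    rw [← comp_way_gen]
    exact left_ne_zero_of_mul hd
  have hd2 : ∀ n, d n 1 ≠ 0 := fun n => by
    have := Finset.prod_ne_zero_iff.1 (right_ne_zero_of_mul hd) n (Finset.mem_univ _)
    rwa [← Function.comp_apply (f := evalInit d), evalInit_comp_gen] at this
  have hd3 : ∀ n, d n = d n 1 • ![d n 0 / d n 1, 1] := fun n => by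
    ext i; fin_cases i
    · simp [mul_div_cancel₀ _ (hd2 n)]
    · simp
  let r : Fin 5 → ℂ := Fin.cons (d none 0 / d none 1) fun n => d (some n) 0 / d (some n) 1
  have hr : wayVec p ![r 0, 1] (fun n => ![r n.succ, 1]) w (w + 1) (w + 2) (w + 3) ≠ 0 := by
    intro h0
    obtain ⟨c, _, hc⟩ := wayVec_smul p ![r 0, 1] (fun n => ![r n.succ, 1]) (d none 1)
      (fun n => d (some n) 1) (hd2 _) (fun n => hd2 _) w (w + 1) (w + 2) (w + 3)
    rw [h0, smul_zero] at hc
    apply hd1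
    rw [way]
    have e1 : d none = d none 1 • ![r 0, 1] := hd3 none
    have e2 : (fun n => d (some n)) = fun n => d (some n) 1 • ![r n.succ, 1] :=
      funext fun n => hd3 (some n)
    rw [e1, e2]
    have := congrFun hc a
    simpa using this
  obtain ⟨b, hb⟩ := Function.ne_iff.1 hr
  -- Generic affine initial data; the wanted polynomial is the coordinate `b` of their way, nonzero
  -- because it does not vanish at `r`.
  let D : Option (Fin 4) → Fin 2 → MvPolynomial (Fin 5) ℂ := fun n =>
    n.elim ![MvPolynomial.X 0, 1] fun n => ![MvPolynomial.X n.succ, 1]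
  have key : ∀ s : Fin 5 → ℂ, MvPolynomial.eval s (way p D w b)
      = wayVec p ![s 0, 1] (fun n => ![s n.succ, 1]) w (w + 1) (w + 2) (w + 3) b := by
    intro s
    have := congrFun (comp_way p (MvPolynomial.aeval s) D w) b
    rw [Function.comp_apply, MvPolynomial.aeval_eq_eval] at this
    refine (this.trans ?_)
    have e1 : MvPolynomial.eval s ∘ D none = ![s 0, 1] := by
      ext i; fin_cases i <;> simp [D]
    have e2 : (fun n => MvPolynomial.eval s ∘ D (some n)) = fun n => ![s n.succ, 1] := by
      funext n; ext i; fin_cases i <;> simp [D]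
    exact congrFun (congrArg₂ (fun A B => wayVec p A B w (w + 1) (w + 2) (w + 3)) e1 e2) b
  refine ⟨way p D w b, ?_, fun s hs h0 => hs ?_⟩
  · intro h0
    have := key r
    rw [h0, map_zero] at this
    exact hb this.symm
  · rw [key, h0]
    rfl

variable {p}
variable {h : Fin 4 → (Fin 2 → InitRing) → (Fin 2 → InitRing) → InitRing}
  {T : Fin 4 → Fin 4 → Fin 4 → (Fin 2 → InitRing) → (Fin 2 → InitRing) → (Fin 2 → InitRing) →
    (Fin 2 → InitRing) → InitRing}
  (hL : TetrahedronLaws p h T)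
  (hedge : ∀ i j, i ≠ j → ∃ X U : Fin 2 → ℂ, edgeDisc (p i j) X U ≠ 0)
  (hdiag : ∀ i j, i ≠ j → ∃ U V : Fin 2 → ℂ, diagDisc (p i j) U V ≠ 0)
include hedge

theorem edgeDisc_gen_ne_zero {i j : Fin 4} (hij : i ≠ j) :
    edgeDisc (p i j) (gen none) (gen (some i)) ≠ 0 := by
  obtain ⟨X, U, hXU⟩ := hedge i j hij
  refine ne_zero_of_map (evalInit fun n => n.elim X fun _ => U) ?_
  simpa [map_edgeDisc, evalInit_comp_gen] using hXU

include hL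

theorem wedge_way_gen_succ (w : Fin 4) : wedge (way p gen w) (way p gen (w + 1)) = 0 := by
  have hk : ∀ k, h k (gen none) (gen (some k)) ≠ 0 := by
    intro k
    obtain ⟨j, hj⟩ := exists_ne k
    obtain ⟨c, _, hc⟩ := hL.edge k j hj.symm
    have := edgeDisc_gen_ne_zero hedge hj.symm
    rw [hc] at this
    exact right_ne_zero_of_mul this
  have e1 : w + 1 + 1 = w + 2 := by revert w; decide
  have e2 : w + 1 + 2 = w + 3 := by revert w; decide
  have e3 : w + 1 + 3 = w := by revert w; decide
  rw [way, way, e1, e2, e3]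
  apply hL.wedge_wayVec
  any_goals (revert w; decide)
  exact hk _

include hdiag

theorem wayVec_gen_ne_zero {i j k l : Fin 4} (hij : i ≠ j) (hik : i ≠ k) (hil : i ≠ l)
    (hjk : j ≠ k) (hjl : j ≠ l) (hkl : k ≠ l) :
    wayVec p (gen none) (fun n => gen (some n)) i j k l ≠ 0 := by
  have hd : ∀ {i j : Fin 4}, i ≠ j → diagDisc (p i j) (gen (some i)) (gen (some j)) ≠ 0 := by
    intro i j hij
    obtain ⟨X, U, hXU⟩ := hdiag i j hij
    refine ne_zero_of_map (evalInit fun n => n.elim 0 fun n => if n = i then X else U) ?_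
    simpa [map_diagDisc, evalInit_comp_gen, hij.symm] using hXU
  refine hL.wayVec_ne_zero hij hik hil hjk hjl ?_ (edgeDisc_gen_ne_zero hedge hjk)
    (edgeDisc_gen_ne_zero hedge hjk.symm) (hd hjk) (hd hjk.symm) ?_
  · exact fun h0 => MvPolynomial.X_ne_zero (R := ℂ) (some i, (0 : Fin 2)) (congrFun h0 0)
  -- The discriminant at the computed points `xⱼₖ, xₖₗ` is nonzero because these points can be
  -- prescribed: with `x, xₖ` fixed on an edge of nonzero discriminant, `xⱼ` and `xₗ` are chosen to
  -- make them multiples of `A` and `C`.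
  · obtain ⟨A, C, hAC⟩ := hdiag j l hjl
    have hk : edgeDisc (p k j) (gen none) (gen (some k)) * edgeDisc (p k l) (gen none) (gen (some k))
        ≠ 0 := mul_ne_zero (edgeDisc_gen_ne_zero hedge hjk.symm) (edgeDisc_gen_ne_zero hedge hkl)
    obtain ⟨d, hd⟩ := exists_evalInit_ne_zero hk
    rw [map_mul, map_edgeDisc, map_edgeDisc, evalInit_comp_gen, evalInit_comp_gen] at hd
    obtain ⟨U, hU⟩ := exists_solve_eq (p k j) (d none) (d (some k)) A
    obtain ⟨V, hV⟩ := exists_solve_eq (p k l) (d none) (d (some k)) C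
    refine ne_zero_of_map (evalInit fun n => n.elim (d none) fun n =>
      if n = j then U else if n = l then V else d (some k)) ?_
    rw [hL.solve_swap hjk.symm, ← neg_one_smul InitRing, diagDisc_smul₁]
    simp [map_diagDisc, evalInit_comp_gen, comp_solve, hjk.symm, hkl, hjl.symm, hU, hV,
      diagDisc_smul₁, diagDisc_smul₂, hAC, left_ne_zero_of_mul hd, right_ne_zero_of_mul hd]

theorem way_gen_ne_zero (w : Fin 4) : way p gen w ≠ 0 := by
  apply wayVec_gen_ne_zero hL hedge hdiag <;> revert w <;> decide

/-- Consecutive ways are proportional, and proportionality is transitive because the generic vectors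
in between do not vanish. -/
theorem wedge_way_gen (w w' : Fin 4) : wedge (way p gen w) (way p gen w') = 0 := by
  have h1 := wedge_way_gen_succ hL hedge
  have h2 : ∀ w, wedge (way p gen w) (way p gen (w + 1 + 1)) = 0 := fun w =>
    wedge_trans (way_gen_ne_zero hL hedge hdiag _) (h1 w) (h1 (w + 1))
  have h3 : ∀ w, wedge (way p gen w) (way p gen (w + 1 + 1 + 1)) = 0 := fun w =>
    wedge_trans (way_gen_ne_zero hL hedge hdiag _) (h2 w) (h1 (w + 1 + 1))
  have h : w' = w ∨ w' = w + 1 ∨ w' = w + 1 + 1 ∨ w' = w + 1 + 1 + 1 := by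
    revert w w'; decide
  rcases h with rfl | rfl | rfl | rfl
  · exact wedge_self _
  · exact h1 w
  · exact h2 w
  · exact h3 w

/-- A polynomial identity may be evaluated anywhere, including at data where the cancellations in
its proof would fail. -/
theorem wedge_way (d : Option (Fin 4) → Fin 2 → ℂ) (w w' : Fin 4) :
    wedge (way p d w) (way p d w') = 0 := by
  have := congrArg (evalInit d) (wedge_way_gen hL hedge hdiag w w')
  rw [← comp_way_gen, ← comp_way_gen]
  simpa [wedge] using this

theorem exists_way_ne_zero (w : Fin 4) : ∃ d : Option (Fin 4) → Fin 2 → ℂ, way p d w ≠ 0 := by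
  obtain ⟨a, ha⟩ := Function.ne_iff.1 (way_gen_ne_zero hL hedge hdiag w)
  obtain ⟨d, hd⟩ := exists_evalInit_ne_zero ha
  refine ⟨d, fun h0 => hd ?_⟩
  rw [← comp_way_gen] at h0
  exact congrFun h0 a

end

/-! ### Transport along Möbius transformations and return to the projective line -/

theorem act_way_mobius (p : Fin 4 → Fin 4 → MvPolynomial (Fin 4) ℂ) (m : GL (Fin 2) ℂ)
    (d : Option (Fin 4) → Fin 2 → ℂ) (w : Fin 4) :
    ∃ c : ℂ, c ≠ 0 ∧ act m.1 (way (fun i j => mobius m (p i j)) d w)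
      = c • way p (fun n => act m.1 (d n)) w :=
  act_wayVec_mobius p m _ _ _ _ _ _

theorem act_zero (m : Matrix (Fin 2) (Fin 2) ℂ) : act m (0 : Fin 2 → ℂ) = 0 := by
  ext i; fin_cases i <;> simp [act]

theorem wedge_way_mobius {p : Fin 4 → Fin 4 → MvPolynomial (Fin 4) ℂ} (m : GL (Fin 2) ℂ)
    (hp : ∀ d : Option (Fin 4) → Fin 2 → ℂ, ∀ w w', wedge (way p d w) (way p d w') = 0)
    (d : Option (Fin 4) → Fin 2 → ℂ) (w w' : Fin 4) :
    wedge (way (fun i j => mobius m (p i j)) d w) (way (fun i j => mobius m (p i j)) d w') = 0 := by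
  have hdet : m.1.det ≠ 0 := m.isUnit.map Matrix.detMonoidHom |>.ne_zero
  obtain ⟨b, _, f⟩ := act_way_mobius p m d w
  obtain ⟨b', _, f'⟩ := act_way_mobius p m d w'
  have h := wedge_act m.1 (way (fun i j => mobius m (p i j)) d w)
    (way (fun i j => mobius m (p i j)) d w')
  rw [f, f', wedge_smul_left, wedge_smul_right, hp, mul_zero, mul_zero, eq_comm, mul_eq_zero] at h
  exact h.resolve_left hdet

theorem exists_way_mobius_ne_zero {p : Fin 4 → Fin 4 → MvPolynomial (Fin 4) ℂ} (m : GL (Fin 2) ℂ)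
    {w : Fin 4} (hp : ∃ d : Option (Fin 4) → Fin 2 → ℂ, way p d w ≠ 0) :
    ∃ d : Option (Fin 4) → Fin 2 → ℂ, way (fun i j => mobius m (p i j)) d w ≠ 0 := by
  obtain ⟨d, hd⟩ := hp
  refine ⟨fun n => act (m⁻¹).1 (d n), fun h0 => ?_⟩
  obtain ⟨b, hb, f⟩ := act_way_mobius p m (fun n => act (m⁻¹).1 (d n)) w
  simp only [act_inv] at f
  rw [h0, act_zero, eq_comm, smul_eq_zero] at f
  exact hd (f.resolve_left hb)

/-- Consistency around the rhombic dodecahedron, for a family of equations whose four ways are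
generically solvable and lead to proportional vectors. -/
theorem consistent_of_wedge {Q : ℂ → ℂ → MvPolynomial (Fin 4) ℂ} {α : Fin 4 → ℂ}
    (h1 : ∀ d : Option (Fin 4) → Fin 2 → ℂ, ∀ w w',
      wedge (way (fun i j => Q (α i) (α j)) d w) (way (fun i j => Q (α i) (α j)) d w') = 0)
    (h2 : ∀ w, ∃ d : Option (Fin 4) → Fin 2 → ℂ, way (fun i j => Q (α i) (α j)) d w ≠ 0) :
    (∀ (x : CP1) (v : Fin 4 → CP1) (w w' : Fin 4) (y y' : CP1),
      Way Q α x v w y → Way Q α x v w' y' → y = y') ∧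
    (∃ P : MvPolynomial (Fin 5) ℂ, P ≠ 0 ∧ ∀ d : Fin 5 → ℂ, MvPolynomial.eval d P ≠ 0 →
      ∃ y : CP1, ∀ w : Fin 4, Way Q α (ofComplex (d 0)) (fun i => ofComplex (d i.succ)) w y) := by
  have part1 : ∀ (x : CP1) (v : Fin 4 → CP1) (w w' : Fin 4) (y y' : CP1),
      Way Q α x v w y → Way Q α x v w' y' → y = y' := by
    intro x v w w' y y' hy hy'
    obtain ⟨c, hc, e⟩ := WayThrough.exists_rep_eq hy
    obtain ⟨c', hc', e'⟩ := WayThrough.exists_rep_eq hy'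
    have h := h1 (fun n => n.elim x.rep fun n => (v n).rep) w w'
    simp only [way, Option.elim, ← e, ← e', wedge_smul_left, wedge_smul_right, mul_eq_zero, hc, hc',
      false_or] at h
    rw [wedge_eq_zero_iff y.rep_nonzero] at h
    rw [← y.mk_rep, ← y'.mk_rep, eq_comm, Projectivization.mk_eq_mk_iff']
    exact h
  refine ⟨part1, ?_⟩
  have key := fun w => exists_polynomial _ (h2 w).choose_spec
  choose P hP0 hP using key
  refine ⟨∏ w, P w, Finset.prod_ne_zero_iff.2 fun w _ => hP0 w, fun d hd => ?_⟩
  rw [map_prod, Finset.prod_ne_zero_iff] at hd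
  have hw : ∀ w : Fin 4, ∃ y, Way Q α (ofComplex (d 0))
      (fun i => ofComplex (d i.succ)) w y := fun w =>
    ⟨_, wayThrough_mk _ _ (hP w d (hd w (Finset.mem_univ _)))⟩
  choose y hy using hw
  refine ⟨y 0, fun w => ?_⟩
  rw [part1 _ _ 0 w _ _ (hy 0) (hy w)]
  exact hy w

/-- The consistency of a family with the tetrahedron property around the rhombic dodecahedron. -/
theorem consistent_of_laws (F : CanonicalForm) (m : GL (Fin 2) ℂ) (α : Fin 4 → ℂ)
    (hL : ∃ h T, TetrahedronLaws (R := InitRing) (fun i j : Fin 4 => F.poly (α i) (α j)) h T)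
    (hedge : ∀ i j, i ≠ j → ∃ X U : Fin 2 → ℂ, edgeDisc (F.poly (α i) (α j)) X U ≠ 0)
    (hdiag : ∀ i j, i ≠ j → ∃ U V : Fin 2 → ℂ, diagDisc (F.poly (α i) (α j)) U V ≠ 0) :
    (∀ (x : CP1) (v : Fin 4 → CP1) (w w' : Fin 4) (y y' : CP1),
      Way (bulk F m) α x v w y → Way (bulk F m) α x v w' y' → y = y') ∧
    (∃ P : MvPolynomial (Fin 5) ℂ, P ≠ 0 ∧ ∀ d : Fin 5 → ℂ, MvPolynomial.eval d P ≠ 0 →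
      ∃ y : CP1, ∀ w : Fin 4,
        Way (bulk F m) α (ofComplex (d 0)) (fun i => ofComplex (d i.succ)) w y) := by
  obtain ⟨h, T, hL⟩ := hL
  exact consistent_of_wedge (wedge_way_mobius m (wedge_way hL hedge hdiag))
    fun w => exists_way_mobius_ne_zero m (exists_way_ne_zero hL hedge hdiag w)

/-! ### Multiaffine polynomials with the symmetries of the square -/

/-- The coefficients of a multiaffine polynomial in `x, u, v, y` that is invariant under the Klein
four-group. -/
@[ext]
structure SymCoeffs (R : Type) where
  /-- the constant coefficient -/
  k₀ : R
  /-- the coefficient of `x + u + v + y` -/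
  k₁ : R
  /-- the coefficient of `xu + vy` -/
  a : R
  /-- the coefficient of `xv + uy` -/
  b : R
  /-- the coefficient of `xy + uv` -/
  c : R
  /-- the coefficient of `xuvy` -/
  k₄ : R

namespace SymCoeffs

open MvPolynomial in
/-- The polynomial with given coefficients. -/
def poly (κ : SymCoeffs ℂ) : MvPolynomial (Fin 4) ℂ :=
  C κ.k₀ + C κ.k₁ * (X 0 + X 1 + X 2 + X 3) + C κ.a * (X 0 * X 1 + X 2 * X 3)
    + C κ.b * (X 0 * X 2 + X 1 * X 3) + C κ.c * (X 0 * X 3 + X 1 * X 2)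
    + C κ.k₄ * (X 0 * X 1 * X 2 * X 3)

/-- The coefficients obtained by exchanging `u` and `v` and changing the sign. -/
def swap {R : Type} [Neg R] (κ : SymCoeffs R) : SymCoeffs R :=
  ⟨-κ.k₀, -κ.k₁, -κ.b, -κ.a, -κ.c, -κ.k₄⟩

/-- The coefficients obtained by exchanging `x` and `u` and changing the sign. -/
def swap' {R : Type} [Neg R] (κ : SymCoeffs R) : SymCoeffs R :=
  ⟨-κ.k₀, -κ.k₁, -κ.a, -κ.c, -κ.b, -κ.k₄⟩

variable {R : Type} [CommRing R]

/-- The quadrilinear form with given coefficients. -/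
def form (κ : SymCoeffs R) (X U V Y : Fin 2 → R) : R :=
  κ.k₀ * (X 1 * U 1 * V 1 * Y 1)
    + κ.k₁ * (X 0 * U 1 * V 1 * Y 1 + X 1 * U 0 * V 1 * Y 1 + X 1 * U 1 * V 0 * Y 1
      + X 1 * U 1 * V 1 * Y 0)
    + κ.a * (X 0 * U 0 * V 1 * Y 1 + X 1 * U 1 * V 0 * Y 0)
    + κ.b * (X 0 * U 1 * V 0 * Y 1 + X 1 * U 0 * V 1 * Y 0)
    + κ.c * (X 0 * U 1 * V 1 * Y 0 + X 1 * U 0 * V 0 * Y 1)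
    + κ.k₄ * (X 0 * U 0 * V 0 * Y 0)

theorem form_swap (κ : SymCoeffs R) (X U V Y : Fin 2 → R) :
    κ.swap.form X V U Y = -κ.form X U V Y := by
  simp only [form, swap]; ring

theorem form_swap' (κ : SymCoeffs R) (X U V Y : Fin 2 → R) :
    κ.swap'.form U X V Y = -κ.form X U V Y := by
  simp only [form, swap']; ring

theorem form_symm (κ : SymCoeffs R) (X U V Y : Fin 2 → R) :
    κ.form U X Y V = κ.form X U V Y := by
  simp only [form]; ring

/-- The solution vector of the equation with given coefficients. -/
def sol (κ : SymCoeffs R) (X U V : Fin 2 → R) : Fin 2 → R :=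
  ![κ.form X U V ![0, 1], -κ.form X U V ![1, 0]]

/-- The discriminant along an edge. -/
def disc (κ : SymCoeffs R) (X U : Fin 2 → R) : R :=
  κ.form X U ![1, 0] ![1, 0] * κ.form X U ![0, 1] ![0, 1]
    - κ.form X U ![1, 0] ![0, 1] * κ.form X U ![0, 1] ![1, 0]

variable [Algebra ℂ R]

/-- Extension of scalars. -/
def map (R : Type) [CommRing R] [Algebra ℂ R] (κ : SymCoeffs ℂ) : SymCoeffs R :=
  ⟨algebraMap ℂ R κ.k₀, algebraMap ℂ R κ.k₁, algebraMap ℂ R κ.a, algebraMap ℂ R κ.b,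
    algebraMap ℂ R κ.c, algebraMap ℂ R κ.k₄⟩

theorem map_swap (κ : SymCoeffs ℂ) : κ.swap.map R = (κ.map R).swap := by
  simp [map, swap]

theorem map_swap' (κ : SymCoeffs ℂ) : κ.swap'.map R = (κ.map R).swap' := by
  simp [map, swap']

theorem face_poly (κ : SymCoeffs ℂ) (X U V Y : Fin 2 → R) :
    face κ.poly X U V Y = (κ.map R).form X U V Y := by
  have h0 (a b : Fin 4 → R) : homEval 1 a b = b 0 * b 1 * b 2 * b 3 := by
    simpa [Fin.prod_univ_four] using homEval_prod_X ∅ a b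
  have h1 (i : Fin 4) (a b : Fin 4 → R) : homEval (MvPolynomial.X i) a b
      = ∏ j, if j = i then a j else b j := by
    simpa using homEval_prod_X {i} a b
  have h2 (i k : Fin 4) (hik : i ≠ k) (a b : Fin 4 → R) :
      homEval (MvPolynomial.X i * MvPolynomial.X k) a b
      = ∏ j, if j = i ∨ j = k then a j else b j := by
    simpa [Finset.prod_pair hik] using homEval_prod_X {i, k} a b
  have h4 (a b : Fin 4 → R) : homEval (MvPolynomial.X 0 * MvPolynomial.X 1 * MvPolynomial.X 2
      * MvPolynomial.X 3) a b = a 0 * a 1 * a 2 * a 3 := by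
    simpa [Fin.prod_univ_four] using homEval_prod_X Finset.univ a b
  rw [poly, ← mul_one (MvPolynomial.C κ.k₀)]
  simp only [face, homEval_add, homEval_C_mul, h0, h1, h4]
  rw [h2 0 1 (by decide), h2 2 3 (by decide), h2 0 2 (by decide), h2 1 3 (by decide),
    h2 0 3 (by decide), h2 1 2 (by decide)]
  simp [Fin.prod_univ_four, form, map]

theorem solve_poly (κ : SymCoeffs ℂ) (X U V : Fin 2 → R) :
    solve κ.poly X U V = (κ.map R).sol X U V := by
  simp only [solve, face_poly, sol]

theorem edgeDisc_poly (κ : SymCoeffs ℂ) (X U : Fin 2 → R) :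
    edgeDisc κ.poly X U = (κ.map R).disc X U := by
  simp only [edgeDisc, face_poly, disc]

/-- At the points `(1 : 0)` and `(0 : 1)` the discriminant is `-ab`. -/
theorem exists_diagDisc_ne_zero {κ : SymCoeffs ℂ} (ha : κ.a ≠ 0) (hb : κ.b ≠ 0) :
    ∃ U V : Fin 2 → ℂ, diagDisc κ.poly U V ≠ 0 := by
  refine ⟨![1, 0], ![0, 1], ?_⟩
  simp [diagDisc, face_poly, form, map, ha, hb]

end SymCoeffs

/-- The form of the tetrahedron property for symmetric coefficients. -/
theorem TetrahedronLaws.of_symCoeffs {R : Type} [CommRing R] [Algebra ℂ R] {ι : Type}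
    {p : ι → ι → MvPolynomial (Fin 4) ℂ} (κ : ι → ι → SymCoeffs ℂ) (hp : ∀ i j, p i j = (κ i j).poly)
    (τ : ι → ι → ι → SymCoeffs ℂ) (h : ι → (Fin 2 → R) → (Fin 2 → R) → R)
    (hκ : ∀ i j, i ≠ j → κ j i = (κ i j).swap)
    (hτ : ∀ i j k, i ≠ j → i ≠ k → j ≠ k → τ j i k = (τ i j k).swap')
    (hτ' : ∀ i j k, i ≠ j → i ≠ k → j ≠ k → τ i k j = (τ i j k).swap)
    (hedge : ∀ i j, i ≠ j → ∃ c : ℂ, c ≠ 0 ∧ ∀ X U : Fin 2 → R,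
      ((κ i j).map R).disc X U = algebraMap ℂ R c * h i X U)
    (htetra : ∀ i j k, i ≠ j → i ≠ k → j ≠ k → ∃ c : ℂ, c ≠ 0 ∧ ∀ X U V Z Y : Fin 2 → R,
      ((κ j k).map R).form U (((κ i j).map R).sol X U V) (((κ i k).map R).sol X U Z) Y
        = algebraMap ℂ R c * h i X U * ((τ i j k).map R).form U V Z Y) :
    TetrahedronLaws (R := R) p h fun i j k => ((τ i j k).map R).form where
  swap i j hij X U V Y := by
    rw [hp, hp, hκ i j hij, SymCoeffs.face_poly, SymCoeffs.face_poly, SymCoeffs.map_swap,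
      SymCoeffs.form_swap]
  symm i j hij X U V Y := by
    rw [hp, SymCoeffs.face_poly, SymCoeffs.face_poly, SymCoeffs.form_symm]
  edge i j hij := by
    simpa only [hp, SymCoeffs.edgeDisc_poly] using hedge i j hij
  swap₁₂ i j k hij hik hjk U V Z Y := by
    rw [hτ i j k hij hik hjk, SymCoeffs.map_swap', SymCoeffs.form_swap']
  swap₂₃ i j k hij hik hjk U V Z Y := by
    rw [hτ' i j k hij hik hjk, SymCoeffs.map_swap, SymCoeffs.form_swap]
  tetra i j k hij hik hjk := by
    simpa only [hp, SymCoeffs.face_poly, SymCoeffs.solve_poly] using htetra i j k hij hik hjk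

/-! ### The rational and the exponential forms -/

section

set_option linter.unusedSimpArgs false

variable {R : Type} [CommRing R] [Algebra ℂ R]

open CanonicalForm SymCoeffs

theorem exp_two_mul (z : ℂ) : Complex.exp (2 * z) = Complex.exp z ^ 2 := by
  rw [← Complex.exp_nat_mul, Nat.cast_ofNat]

/-- The coefficients of `Q1`. -/
def coeffsQ1 (δ α β : ℂ) : SymCoeffs ℂ := ⟨δ ^ 2 * α * β * (α - β), 0, α, -β, β - α, 0⟩

theorem poly_Q1 (δ α β : ℂ) : (Q1 δ).poly α β = (coeffsQ1 δ α β).poly := by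
  simp only [CanonicalForm.poly, SymCoeffs.poly, coeffsQ1, map_mul, map_sub, map_neg, map_pow,
    map_add, map_zero, map_one, exp_two_mul]
  ring

/-- The tetrahedron relation is `Q1 δ` itself with the parameters `αⱼ - αᵢ` and `αₖ - αᵢ`; the edge
biquadratic is `(x - u)² - δ²αᵢ²`. -/
theorem laws_Q1 {ι : Type} (δ : ℂ) {α : ι → ℂ} (h0 : ∀ i, α i ≠ 0)
    (h1 : ∀ i j, i ≠ j → α i ≠ α j) :
    ∃ h T, TetrahedronLaws (R := R) (fun i j => (Q1 δ).poly (α i) (α j)) h T := by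
  refine ⟨_, _, .of_symCoeffs (fun i j => _) (fun i j => poly_Q1 _ _ _)
    (fun i j k => ⟨δ ^ 2 * (α i - α j) * (α i - α k) * (α j - α k), 0, α j - α i, α i - α k, α k - α j, 0⟩)
    (fun i X U => (X 0 * U 1 - X 1 * U 0) ^ 2
      - algebraMap ℂ R (α i ^ 2 * δ ^ 2) * (X 1 * U 1) ^ 2) ?_ ?_ ?_ ?_ ?_⟩
  · intro i j _
    ext <;> simp only [coeffsQ1, swap] <;> ring
  · intro i j k _ _ _
    ext <;> simp only [swap'] <;> ring
  · intro i j k _ _ _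
    ext <;> simp only [swap] <;> ring
  · intro i j hij
    refine ⟨α j * (α j - α i), mul_ne_zero (h0 j) (sub_ne_zero.2 (h1 j i hij.symm)), fun X U => ?_⟩
    simp only [coeffsQ1, SymCoeffs.map, disc, form, map_mul, map_sub, map_neg, map_pow, map_add,
      map_zero, map_one, map_ofNat, Matrix.cons_val]
    ring
  · intro i j k _ _ _
    refine ⟨α j * α k, mul_ne_zero (h0 j) (h0 k), fun X U V Z Y => ?_⟩
    simp only [coeffsQ1, SymCoeffs.map, sol, form, map_mul, map_sub, map_neg, map_pow, map_add,
      map_zero, map_one, map_ofNat, Matrix.cons_val]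
    ring

/-- The coefficients of `Q2`. -/
def coeffsQ2 (α β : ℂ) : SymCoeffs ℂ :=
  ⟨-(α * β * (α - β) * (α ^ 2 - α * β + β ^ 2)), α * β * (α - β), α, -β, β - α, 0⟩

theorem poly_Q2 (α β : ℂ) : Q2.poly α β = (coeffsQ2 α β).poly := by
  simp only [CanonicalForm.poly, SymCoeffs.poly, coeffsQ2, map_mul, map_sub, map_neg, map_pow,
    map_add, map_zero, map_one, exp_two_mul]
  ring

/-- Again the tetrahedron relation is the equation itself with the parameters `αⱼ - αᵢ`, `αₖ - αᵢ`.
-/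
theorem laws_Q2 {ι : Type} {α : ι → ℂ} (h0 : ∀ i, α i ≠ 0)
    (h1 : ∀ i j, i ≠ j → α i ≠ α j) :
    ∃ h T, TetrahedronLaws (R := R) (fun i j => Q2.poly (α i) (α j)) h T := by
  refine ⟨_, _, .of_symCoeffs (fun i j => _) (fun i j => poly_Q2 _ _)
    (fun i j k => ⟨-((α i - α j) * (α i - α k) * (α j - α k)
      * ((α i - α k) ^ 2 - (α i - α k) * (α i - α j) + (α i - α j) ^ 2)),
      (α i - α j) * (α i - α k) * (α j - α k), α j - α i, α i - α k, α k - α j, 0⟩)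
    (fun i X U => (X 0 * U 1 - X 1 * U 0) ^ 2
      - algebraMap ℂ R (2 * α i ^ 2) * (X 1 * U 1 * (X 0 * U 1 + X 1 * U 0))
      + algebraMap ℂ R (α i ^ 4) * (X 1 * U 1) ^ 2) ?_ ?_ ?_ ?_ ?_⟩
  · intro i j _
    ext <;> simp only [coeffsQ2, swap] <;> ring
  · intro i j k _ _ _
    ext <;> simp only [swap'] <;> ring
  · intro i j k _ _ _
    ext <;> simp only [swap] <;> ring
  · intro i j hij
    refine ⟨α j * (α j - α i), mul_ne_zero (h0 j) (sub_ne_zero.2 (h1 j i hij.symm)), fun X U => ?_⟩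
    simp only [coeffsQ2, SymCoeffs.map, disc, form, map_mul, map_sub, map_neg, map_pow, map_add,
      map_zero, map_one, map_ofNat, Matrix.cons_val]
    ring
  · intro i j k _ _ _
    refine ⟨α j * α k, mul_ne_zero (h0 j) (h0 k), fun X U V Z Y => ?_⟩
    simp only [coeffsQ2, SymCoeffs.map, sol, form, map_mul, map_sub, map_neg, map_pow, map_add,
      map_zero, map_one, map_ofNat, Matrix.cons_val]
    ring

/-- The coefficients of `A1`. -/
def coeffsA1 (δ α β : ℂ) : SymCoeffs ℂ := ⟨-(δ ^ 2 * α * β * (α - β)), 0, α, -β, α - β, 0⟩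

theorem poly_A1 (δ α β : ℂ) : (A1 δ).poly α β = (coeffsA1 δ α β).poly := by
  simp only [CanonicalForm.poly, SymCoeffs.poly, coeffsA1, map_mul, map_sub, map_neg, map_pow,
    map_add, map_zero, map_one, exp_two_mul]
  ring

/-- The tetrahedron relation is minus that of `Q1 δ`; the edge biquadratic differs from the one of
`Q1` by the sign of `u`. -/
theorem laws_A1 {ι : Type} (δ : ℂ) {α : ι → ℂ} (h0 : ∀ i, α i ≠ 0)
    (h1 : ∀ i j, i ≠ j → α i ≠ α j) :
    ∃ h T, TetrahedronLaws (R := R) (fun i j => (A1 δ).poly (α i) (α j)) h T := by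
  refine ⟨_, _, .of_symCoeffs (fun i j => _) (fun i j => poly_A1 _ _ _)
    (fun i j k => ⟨-(δ ^ 2 * (α i - α j) * (α i - α k) * (α j - α k)), 0, α i - α j, α k - α i,
      α j - α k, 0⟩)
    (fun i X U => (X 0 * U 1 + X 1 * U 0) ^ 2
      - algebraMap ℂ R (α i ^ 2 * δ ^ 2) * (X 1 * U 1) ^ 2) ?_ ?_ ?_ ?_ ?_⟩
  · intro i j _
    ext <;> simp only [coeffsA1, swap] <;> ring
  · intro i j k _ _ _
    ext <;> simp only [swap'] <;> ring
  · intro i j k _ _ _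
    ext <;> simp only [swap] <;> ring
  · intro i j hij
    refine ⟨α j * (α i - α j), mul_ne_zero (h0 j) (sub_ne_zero.2 (h1 i j hij)), fun X U => ?_⟩
    simp only [coeffsA1, SymCoeffs.map, disc, form, map_mul, map_sub, map_neg, map_pow, map_add,
      map_zero, map_one, map_ofNat, Matrix.cons_val]
    ring
  · intro i j k _ _ _
    refine ⟨α j * α k, mul_ne_zero (h0 j) (h0 k), fun X U V Z Y => ?_⟩
    simp only [coeffsA1, SymCoeffs.map, sol, form, map_mul, map_sub, map_neg, map_pow, map_add,
      map_zero, map_one, map_ofNat, Matrix.cons_val]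
    ring

/-- The coefficients of `H1`. -/
def coeffsH1 (α β : ℂ) : SymCoeffs ℂ := ⟨β - α, 0, 1, -1, 0, 0⟩

theorem poly_H1 (α β : ℂ) : H1.poly α β = (coeffsH1 α β).poly := by
  simp only [CanonicalForm.poly, SymCoeffs.poly, coeffsH1, map_mul, map_sub, map_neg, map_pow,
    map_add, map_zero, map_one, exp_two_mul]
  ring

/-- The tetrahedron relation is of type `Q1 0`, in the parameter differences. -/
theorem laws_H1 {ι : Type} {α : ι → ℂ} (h1 : ∀ i j, i ≠ j → α i ≠ α j) :
    ∃ h T, TetrahedronLaws (R := R) (fun i j => H1.poly (α i) (α j)) h T := by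
  refine ⟨_, _, .of_symCoeffs (fun i j => _) (fun i j => poly_H1 _ _)
    (fun i j k => ⟨0, 0, α j - α i, α i - α k, α k - α j, 0⟩)
    (fun i X U => (X 1 * U 1) ^ 2) ?_ ?_ ?_ ?_ ?_⟩
  · intro i j _
    ext <;> simp only [coeffsH1, swap] <;> ring
  · intro i j k _ _ _
    ext <;> simp only [swap'] <;> ring
  · intro i j k _ _ _
    ext <;> simp only [swap] <;> ring
  · intro i j hij
    refine ⟨α j - α i, sub_ne_zero.2 (h1 j i hij.symm), fun X U => ?_⟩
    simp only [coeffsH1, SymCoeffs.map, disc, form, map_mul, map_sub, map_neg, map_pow, map_add,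
      map_zero, map_one, map_ofNat, Matrix.cons_val]
    ring
  · intro i j k _ _ _
    refine ⟨1, one_ne_zero, fun X U V Z Y => ?_⟩
    simp only [coeffsH1, SymCoeffs.map, sol, form, map_mul, map_sub, map_neg, map_pow, map_add,
      map_zero, map_one, map_ofNat, Matrix.cons_val]
    ring

/-- The coefficients of `H2`. -/
def coeffsH2 (α β : ℂ) : SymCoeffs ℂ := ⟨β ^ 2 - α ^ 2, β - α, 1, -1, 0, 0⟩

theorem poly_H2 (α β : ℂ) : H2.poly α β = (coeffsH2 α β).poly := by
  simp only [CanonicalForm.poly, SymCoeffs.poly, coeffsH2, map_mul, map_sub, map_neg, map_pow,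
    map_add, map_zero, map_one, exp_two_mul]
  ring

/-- The tetrahedron relation is of type `Q1 1`; the edge biquadratic is `x + u + αᵢ`. -/
theorem laws_H2 {ι : Type} {α : ι → ℂ} (h1 : ∀ i j, i ≠ j → α i ≠ α j) :
    ∃ h T, TetrahedronLaws (R := R) (fun i j => H2.poly (α i) (α j)) h T := by
  refine ⟨_, _, .of_symCoeffs (fun i j => _) (fun i j => poly_H2 _ _)
    (fun i j k => ⟨(α i - α j) * (α i - α k) * (α j - α k), 0, α j - α i, α i - α k, α k - α j, 0⟩)
    (fun i X U => X 1 * U 1 * (X 0 * U 1 + X 1 * U 0 + algebraMap ℂ R (α i) * (X 1 * U 1))) ?_ ?_ ?_ ?_ ?_⟩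
  · intro i j _
    ext <;> simp only [coeffsH2, swap] <;> ring
  · intro i j k _ _ _
    ext <;> simp only [swap'] <;> ring
  · intro i j k _ _ _
    ext <;> simp only [swap] <;> ring
  · intro i j hij
    refine ⟨2 * (α j - α i), mul_ne_zero two_ne_zero (sub_ne_zero.2 (h1 j i hij.symm)), fun X U => ?_⟩
    simp only [coeffsH2, SymCoeffs.map, disc, form, map_mul, map_sub, map_neg, map_pow, map_add,
      map_zero, map_one, map_ofNat, Matrix.cons_val]
    ring
  · intro i j k _ _ _
    refine ⟨2, two_ne_zero, fun X U V Z Y => ?_⟩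
    simp only [coeffsH2, SymCoeffs.map, sol, form, map_mul, map_sub, map_neg, map_pow, map_add,
      map_zero, map_one, map_ofNat, Matrix.cons_val]
    ring

/-- The coefficients of `H3`. -/
def coeffsH3 (δ α β : ℂ) : SymCoeffs ℂ := ⟨δ * (α ^ 2 - β ^ 2), 0, α, -β, 0, 0⟩

theorem poly_H3 (δ α β : ℂ) : (H3 δ).poly α β = (coeffsH3 δ (Complex.exp α) (Complex.exp β)).poly := by
  simp only [CanonicalForm.poly, SymCoeffs.poly, coeffsH3, map_mul, map_sub, map_neg, map_pow,
    map_add, map_zero, map_one, exp_two_mul]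
  ring

/-- The tetrahedron relation is, up to a factor, of type `Q3 0` in the parameter differences,
because `e^γ (e^{2α} - e^{2β}) = 2 e^{α+β+γ} sinh (α - β)`. -/
theorem laws_H3 {ι : Type} (δ : ℂ) {α : ι → ℂ}
    (h1 : ∀ i j, i ≠ j → Complex.exp (α i) ^ 2 ≠ Complex.exp (α j) ^ 2) :
    ∃ h T, TetrahedronLaws (R := R) (fun i j => (H3 δ).poly (α i) (α j)) h T := by
  refine ⟨_, _, .of_symCoeffs (fun i j => _) (fun i j => poly_H3 _ _ _)
    (fun i j k => ⟨0, 0, Complex.exp (α k) * (Complex.exp (α i) ^ 2 - Complex.exp (α j) ^ 2),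
      -(Complex.exp (α j) * (Complex.exp (α i) ^ 2 - Complex.exp (α k) ^ 2)),
      Complex.exp (α i) * (Complex.exp (α j) ^ 2 - Complex.exp (α k) ^ 2), 0⟩)
    (fun i X U => X 1 * U 1 * (X 0 * U 0
      + algebraMap ℂ R (δ * Complex.exp (α i)) * (X 1 * U 1))) ?_ ?_ ?_ ?_ ?_⟩
  · intro i j _
    ext <;> simp only [coeffsH3, swap] <;> ring
  · intro i j k _ _ _
    ext <;> simp only [swap'] <;> ring
  · intro i j k _ _ _
    ext <;> simp only [swap] <;> ring
  · intro i j hij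
    refine ⟨Complex.exp (α i) ^ 2 - Complex.exp (α j) ^ 2, sub_ne_zero.2 (h1 i j hij), fun X U => ?_⟩
    simp only [coeffsH3, SymCoeffs.map, disc, form, map_mul, map_sub, map_neg, map_pow, map_add,
      map_zero, map_one, map_ofNat, Matrix.cons_val]
    ring
  · intro i j k _ _ _
    refine ⟨1, one_ne_zero, fun X U V Z Y => ?_⟩
    simp only [coeffsH3, SymCoeffs.map, sol, form, map_mul, map_sub, map_neg, map_pow, map_add,
      map_zero, map_one, map_ofNat, Matrix.cons_val]
    ring

end

/-! ### The hyperbolic and the elliptic forms -/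

open SymCoeffs

section
variable {R : Type} [CommRing R]

/-- The coefficients of `Q3` and `Q4`. -/
def coeffsEll (δ κ a b c : R) : SymCoeffs R := ⟨δ * (c * a * b), 0, a, -b, -c, κ * (c * a * b)⟩

/-- The coefficients of `A2`. -/
def coeffsA2 (a b c : R) : SymCoeffs R := ⟨-c, 0, -b, a, 0, -c⟩

/-- Only the coefficient of `xu` needs an argument: `hR` extracts the factor `bc` and leaves `2A`.
For `sinh` the number `A` is `cosh α`. -/
theorem disc_coeffsEll {δ κ a b c A : R}
    (hR : a ^ 2 - b ^ 2 - c ^ 2 + δ * κ * a ^ 2 * b ^ 2 * c ^ 2 - 2 * b * c * A = 0)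
    (X U : Fin 2 → R) :
    (coeffsEll δ κ a b c).disc X U = b * c * (δ * a ^ 2 * (X 1 * U 1) ^ 2
      + κ * a ^ 2 * (X 0 * U 0) ^ 2 - (X 0 * U 1) ^ 2 - (X 1 * U 0) ^ 2
      + 2 * A * (X 0 * X 1 * U 0 * U 1)) := by
  simp only [coeffsEll, disc, form, Matrix.cons_val]
  linear_combination (X 0 * X 1 * U 0 * U 1) * hR

theorem disc_coeffsA2 {a b c A : R} (hR : a ^ 2 - b ^ 2 - c ^ 2 - 2 * b * c * A = 0)
    (X U : Fin 2 → R) :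
    (coeffsA2 a b c).disc X U = b * c * ((X 1 * U 1) ^ 2 + (X 0 * U 0) ^ 2
      - 2 * A * (X 0 * X 1 * U 0 * U 1)) := by
  simp only [coeffsA2, disc, form, Matrix.cons_val]
  linear_combination -(X 0 * X 1 * U 0 * U 1) * hR

/-- The identity holds monomial by monomial, each coefficient being a combination of the five
relations. Here `a, b, c` stand for the function at `αᵢ, αⱼ, αₖ`, and `p, q, r` for its values at
the differences `ij, ik, jk`. -/
theorem tetra_coeffsEll {δ κ a b c p q r A : R}
    (hI : a * r - b * q + c * p - δ * κ * a * b * c * p * q * r = 0)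
    (hII : a * b * p - a * c * q + b * c * r - p * q * r = 0)
    (hR : a ^ 2 - b ^ 2 - p ^ 2 + δ * κ * a ^ 2 * b ^ 2 * p ^ 2 - 2 * b * p * A = 0)
    (hR' : a ^ 2 - c ^ 2 - q ^ 2 + δ * κ * a ^ 2 * c ^ 2 * q ^ 2 - 2 * c * q * A = 0)
    (hIII : a * b ^ 2 - a * c ^ 2 - 2 * b * c * r * A - b * q * r - c * p * r
      + δ * κ * (a ^ 2 * b ^ 2 * c * p * r + a ^ 2 * b * c ^ 2 * q * r) = 0)
    (X U V Z Y : Fin 2 → R) :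
    (coeffsEll δ κ b c r).form U ((coeffsEll δ κ a b p).sol X U V)
      ((coeffsEll δ κ a c q).sol X U Z) Y
      = -(b * c) * (δ * a ^ 2 * (X 1 * U 1) ^ 2
        + κ * a ^ 2 * (X 0 * U 0) ^ 2 - (X 0 * U 1) ^ 2 - (X 1 * U 0) ^ 2
        + 2 * A * (X 0 * X 1 * U 0 * U 1))
        * (⟨δ * (p * q * r), 0, -p, q, -r, κ * (p * q * r)⟩ : SymCoeffs R).form U V Z Y := by
  simp only [coeffsEll, sol, form, Matrix.cons_val]
  linear_combination
      ((-(a * b * c * δ)) * (X 1 ^ 2 * U 0 * U 1 ^ 2 * V 1 * Z 1 * Y 0)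
        + (-a) * (X 1 ^ 2 * U 0 * U 1 ^ 2 * V 0 * Z 0 * Y 0)
        + (b) * (X 1 ^ 2 * U 0 ^ 2 * U 1 * V 1 * Z 0 * Y 0)
        + (c) * (X 1 ^ 2 * U 0 ^ 2 * U 1 * V 0 * Z 1 * Y 0)
        + (-(δ * a * b * p)) * (X 0 * X 1 * U 0 * U 1 ^ 2 * V 1 * Z 1 * Y 1)
        + (p) * (X 0 * X 1 * U 0 * U 1 ^ 2 * V 1 * Z 0 * Y 0)
        + (q) * (X 0 * X 1 * U 0 * U 1 ^ 2 * V 0 * Z 1 * Y 0)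
        + (q) * (X 0 * X 1 * U 0 ^ 2 * U 1 * V 1 * Z 0 * Y 1)
        + (p) * (X 0 * X 1 * U 0 ^ 2 * U 1 * V 0 * Z 1 * Y 1)
        + (-(κ * a * b * p)) * (X 0 * X 1 * U 0 ^ 2 * U 1 * V 0 * Z 0 * Y 0)
        + (c) * (X 0 ^ 2 * U 0 * U 1 ^ 2 * V 1 * Z 0 * Y 1)
        + (b) * (X 0 ^ 2 * U 0 * U 1 ^ 2 * V 0 * Z 1 * Y 1)
        + (-a) * (X 0 ^ 2 * U 0 ^ 2 * U 1 * V 1 * Z 1 * Y 1)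
        + (-(a * b * c * κ)) * (X 0 ^ 2 * U 0 ^ 2 * U 1 * V 0 * Z 0 * Y 1)) * hI
      + ((-(a * b * δ)) * (X 1 ^ 2 * U 0 * U 1 ^ 2 * V 1 * Z 0 * Y 1)
        + (-(a * c * δ)) * (X 1 ^ 2 * U 0 * U 1 ^ 2 * V 0 * Z 1 * Y 1)
        + (b * c * δ) * (X 1 ^ 2 * U 0 ^ 2 * U 1 * V 1 * Z 1 * Y 1)
        + (1) * (X 1 ^ 2 * U 0 ^ 2 * U 1 * V 0 * Z 0 * Y 1)
        + (δ * p * c) * (X 0 * X 1 * U 0 * U 1 ^ 2 * V 1 * Z 1 * Y 1)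
        + (-(p * δ * κ * a * b * c)) * (X 0 * X 1 * U 0 * U 1 ^ 2 * V 1 * Z 0 * Y 0)
        + (-(q * δ * κ * a * b * c)) * (X 0 * X 1 * U 0 * U 1 ^ 2 * V 0 * Z 1 * Y 0)
        + (-(q * δ * κ * a * b * c)) * (X 0 * X 1 * U 0 ^ 2 * U 1 * V 1 * Z 0 * Y 1)
        + (-(p * δ * κ * a * b * c)) * (X 0 * X 1 * U 0 ^ 2 * U 1 * V 0 * Z 1 * Y 1)
        + (κ * p * c) * (X 0 * X 1 * U 0 ^ 2 * U 1 * V 0 * Z 0 * Y 0)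
        + (1) * (X 0 ^ 2 * U 0 * U 1 ^ 2 * V 1 * Z 1 * Y 0)
        + (b * c * κ) * (X 0 ^ 2 * U 0 * U 1 ^ 2 * V 0 * Z 0 * Y 0)
        + (-(a * c * κ)) * (X 0 ^ 2 * U 0 ^ 2 * U 1 * V 1 * Z 0 * Y 0)
        + (-(a * b * κ)) * (X 0 ^ 2 * U 0 ^ 2 * U 1 * V 0 * Z 1 * Y 0)) * hII
      + ((-(δ * c * q * r)) * (X 0 * X 1 * U 0 * U 1 ^ 2 * V 1 * Z 1 * Y 1)
        + (c) * (X 0 * X 1 * U 0 * U 1 ^ 2 * V 1 * Z 0 * Y 0)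
        + (c) * (X 0 * X 1 * U 0 ^ 2 * U 1 * V 0 * Z 1 * Y 1)
        + (-(κ * c * q * r)) * (X 0 * X 1 * U 0 ^ 2 * U 1 * V 0 * Z 0 * Y 0)) * hR
      + ((-b) * (X 0 * X 1 * U 0 * U 1 ^ 2 * V 0 * Z 1 * Y 0)
        + (-b) * (X 0 * X 1 * U 0 ^ 2 * U 1 * V 1 * Z 0 * Y 1)) * hR'
      + ((1) * (X 0 * X 1 * U 0 * U 1 ^ 2 * V 0 * Z 0 * Y 1)
        + (1) * (X 0 * X 1 * U 0 ^ 2 * U 1 * V 1 * Z 1 * Y 0)) * hIII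

theorem tetra_coeffsA2 {a b c p q r A : R}
    (hI : a * r - b * q + c * p = 0)
    (hII : a * b * p - a * c * q + b * c * r - p * q * r = 0)
    (hR : a ^ 2 - b ^ 2 - p ^ 2 - 2 * b * p * A = 0)
    (hR' : a ^ 2 - c ^ 2 - q ^ 2 - 2 * c * q * A = 0)
    (hIII : a * b ^ 2 - a * c ^ 2 - 2 * b * c * r * A - b * q * r - c * p * r = 0)
    (X U V Z Y : Fin 2 → R) :
    (coeffsA2 b c r).form U ((coeffsA2 a b p).sol X U V) ((coeffsA2 a c q).sol X U Z) Y
      = b * c * ((X 1 * U 1) ^ 2 + (X 0 * U 0) ^ 2 - 2 * A * (X 0 * X 1 * U 0 * U 1))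
        * (⟨0, 0, -p, q, -r, 0⟩ : SymCoeffs R).form U V Z Y := by
  simp only [coeffsA2, sol, form, Matrix.cons_val]
  linear_combination
      ((1) * (X 1 ^ 2 * U 0 * U 1 ^ 2 * V 1 * Z 1 * Y 0)
        + (1) * (X 0 ^ 2 * U 0 ^ 2 * U 1 * V 0 * Z 0 * Y 1)) * hII
      + ((c) * (X 1 ^ 2 * U 0 * U 1 ^ 2 * V 1 * Z 0 * Y 1)
        + (b) * (X 1 ^ 2 * U 0 * U 1 ^ 2 * V 0 * Z 1 * Y 1)
        + (-a) * (X 1 ^ 2 * U 0 ^ 2 * U 1 * V 1 * Z 1 * Y 1)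
        + (p) * (X 0 * X 1 * U 0 * U 1 ^ 2 * V 1 * Z 0 * Y 0)
        + (q) * (X 0 * X 1 * U 0 * U 1 ^ 2 * V 0 * Z 1 * Y 0)
        + (q) * (X 0 * X 1 * U 0 ^ 2 * U 1 * V 1 * Z 0 * Y 1)
        + (p) * (X 0 * X 1 * U 0 ^ 2 * U 1 * V 0 * Z 1 * Y 1)
        + (-a) * (X 0 ^ 2 * U 0 * U 1 ^ 2 * V 0 * Z 0 * Y 0)
        + (b) * (X 0 ^ 2 * U 0 ^ 2 * U 1 * V 1 * Z 0 * Y 0)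
        + (c) * (X 0 ^ 2 * U 0 ^ 2 * U 1 * V 0 * Z 1 * Y 0)) * hI
      + ((c) * (X 0 * X 1 * U 0 * U 1 ^ 2 * V 1 * Z 0 * Y 0)
        + (c) * (X 0 * X 1 * U 0 ^ 2 * U 1 * V 0 * Z 1 * Y 1)) * hR
      + ((-b) * (X 0 * X 1 * U 0 * U 1 ^ 2 * V 0 * Z 1 * Y 0)
        + (-b) * (X 0 * X 1 * U 0 ^ 2 * U 1 * V 1 * Z 0 * Y 1)) * hR'
      + ((1) * (X 0 * X 1 * U 0 * U 1 ^ 2 * V 0 * Z 0 * Y 1)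
        + (1) * (X 0 * X 1 * U 0 ^ 2 * U 1 * V 1 * Z 1 * Y 0)) * hIII

/-- The addition relations between the values `a i` of a function at the parameters `α i` and its
values `c i j` at the differences `α i - α j`. -/
structure AdditionRelations {ι : Type} (K : ℂ) (a : ι → ℂ) (c : ι → ι → ℂ) : Prop where
  neg : ∀ i j, i ≠ j → c j i = -c i j
  ne_zero : ∀ i, a i ≠ 0
  ne_zero' : ∀ i j, i ≠ j → c i j ≠ 0
  rel : ∀ i j k, i ≠ j → i ≠ k → j ≠ k →
    a i * c j k - a j * c i k + a k * c i j - K * a i * a j * a k * c i j * c i k * c j k = 0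
  rel' : ∀ i j k, i ≠ j → i ≠ k → j ≠ k →
    a i * a j * c i j - a i * a k * c i k + a j * a k * c j k - c i j * c i k * c j k = 0

namespace AdditionRelations

variable {ι : Type} {K : ℂ} {a : ι → ℂ} {c : ι → ι → ℂ} (H : AdditionRelations K a c)
include H

/-- There are numbers `A i` that play the role of the derivatives at the parameters `α i`. -/
theorem exists_deriv : ∃ A : ι → ℂ, ∀ i j, i ≠ j →
    a i ^ 2 - a j ^ 2 - c i j ^ 2 + K * a i ^ 2 * a j ^ 2 * c i j ^ 2 - 2 * a j * c i j * A i = 0 := by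
  have key : ∀ i, ∃ A : ℂ, ∀ j, i ≠ j → a i ^ 2 - a j ^ 2 - c i j ^ 2
      + K * a i ^ 2 * a j ^ 2 * c i j ^ 2 - 2 * a j * c i j * A = 0 := by
    intro i
    by_cases hi : ∃ j, i ≠ j
    · obtain ⟨j, hij⟩ := hi
      have hj := H.ne_zero j
      have hij' := H.ne_zero' i j hij
      refine ⟨(a i ^ 2 - a j ^ 2 - c i j ^ 2 + K * a i ^ 2 * a j ^ 2 * c i j ^ 2)
        / (2 * a j * c i j), fun k hik => ?_⟩
      by_cases hjk : j = k
      · subst hjk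
        field_simp
        ring
      -- The quotient defining `A` does not depend on `j`: the cross difference for `j` and `k`
      -- vanishes after multiplication by `c j k`, which is nonzero.
      · have h1 : c j k * (a k * c i k * (a i ^ 2 - a j ^ 2 - c i j ^ 2
            + K * a i ^ 2 * a j ^ 2 * c i j ^ 2) - a j * c i j * (a i ^ 2 - a k ^ 2 - c i k ^ 2
            + K * a i ^ 2 * a k ^ 2 * c i k ^ 2)) = 0 := by
          linear_combination a i * (a k * c i k - a j * c i j) * H.rel i j k hij hik hjk
            + (a k * c i j - a j * c i k) * H.rel' i j k hij hik hjk
        have h2 := (mul_eq_zero.1 h1).resolve_left (H.ne_zero' j k hjk)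
        field_simp
        linear_combination -h2
    · push Not at hi
      exact ⟨0, fun j hij => absurd (hi j) hij⟩
  choose A hA using key
  exact ⟨A, fun i j hij => hA i j hij⟩

/-- A combination of the other relations once multiplied by `a i`, which is then cancelled. It
supplies `hIII` in the tetrahedron identities. -/
theorem third {A : ι → ℂ} (hA : ∀ i j, i ≠ j → a i ^ 2 - a j ^ 2 - c i j ^ 2
      + K * a i ^ 2 * a j ^ 2 * c i j ^ 2 - 2 * a j * c i j * A i = 0)
    {i j k : ι} (hij : i ≠ j) (hik : i ≠ k) (hjk : j ≠ k) :
    a i * a j ^ 2 - a i * a k ^ 2 - 2 * a j * a k * c j k * A i - a j * c i k * c j k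
      - a k * c i j * c j k + K * (a i ^ 2 * a j ^ 2 * a k * c i j * c j k
      + a i ^ 2 * a j * a k ^ 2 * c i k * c j k) = 0 := by
  refine (mul_eq_zero.1 ?_).resolve_left (H.ne_zero i)
  linear_combination a j ^ 2 * hA i k hik - a k ^ 2 * hA i j hij
    + K * a i * a j * a k ^ 2 * c i k * c j k * hA i j hij
    - 2 * a j * a k * A i * H.rel i j k hij hik hjk
    - (a j * c i k + a k * c i j) * H.rel i j k hij hik hjk
    + K * a i * a j * a k * (a j * c i k * H.rel' i j k hij hik hjk
      + a i * a j * c i j * H.rel i j k hij hik hjk)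

variable [Algebra ℂ R]

theorem laws_coeffsEll {δ κ : ℂ} (hK : K = δ * κ) {p : ι → ι → MvPolynomial (Fin 4) ℂ}
    (hp : ∀ i j, p i j = (coeffsEll δ κ (a i) (a j) (c i j)).poly) :
    ∃ h T, TetrahedronLaws (R := R) p h T := by
  subst hK
  obtain ⟨A, hA⟩ := H.exists_deriv
  have hA' : ∀ i j, i ≠ j → _ := fun i j hij => congrArg (algebraMap ℂ R) (hA i j hij)
  have h1 : ∀ i j k, i ≠ j → i ≠ k → j ≠ k → _ := fun i j k hij hik hjk =>
    congrArg (algebraMap ℂ R) (H.rel i j k hij hik hjk)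
  have h2 : ∀ i j k, i ≠ j → i ≠ k → j ≠ k → _ := fun i j k hij hik hjk =>
    congrArg (algebraMap ℂ R) (H.rel' i j k hij hik hjk)
  have h3 : ∀ i j k, i ≠ j → i ≠ k → j ≠ k → _ := fun i j k hij hik hjk =>
    congrArg (algebraMap ℂ R) (H.third hA hij hik hjk)
  simp only [map_mul, map_sub, map_add, map_pow, map_zero, map_ofNat] at hA' h1 h2 h3
  refine ⟨_, _, .of_symCoeffs (fun i j => _) hp
    -- The same equation with the parameters `αⱼ - αᵢ` and `αₖ - αᵢ`.
    (fun i j k => ⟨δ * (c i j * c i k * c j k), 0, -c i j, c i k, -c j k,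
      κ * (c i j * c i k * c j k)⟩)
    (fun i X U => algebraMap ℂ R δ * algebraMap ℂ R (a i) ^ 2 * (X 1 * U 1) ^ 2
      + algebraMap ℂ R κ * algebraMap ℂ R (a i) ^ 2 * (X 0 * U 0) ^ 2 - (X 0 * U 1) ^ 2
      - (X 1 * U 0) ^ 2 + 2 * algebraMap ℂ R (A i) * (X 0 * X 1 * U 0 * U 1)) ?_ ?_ ?_ ?_ ?_⟩
  · intro i j hij
    ext <;> simp only [coeffsEll, swap, H.neg i j hij] <;> ring
  · intro i j k hij _ _
    ext <;> simp only [swap', H.neg i j hij] <;> ring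
  · intro i j k _ _ hjk
    ext <;> simp only [swap, H.neg j k hjk] <;> ring
  · intro i j hij
    refine ⟨a j * c i j, mul_ne_zero (H.ne_zero j) (H.ne_zero' i j hij), fun X U => ?_⟩
    rw [map_mul, ← disc_coeffsEll (hA' i j hij)]
    simp only [coeffsEll, SymCoeffs.map, map_mul, map_neg, map_zero]
  · intro i j k hij hik hjk
    refine ⟨-(a j * a k), neg_ne_zero.2 (mul_ne_zero (H.ne_zero j) (H.ne_zero k)),
      fun X U V Z Y => ?_⟩
    have := tetra_coeffsEll (h1 i j k hij hik hjk) (h2 i j k hij hik hjk) (hA' i j hij)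
      (hA' i k hik) (h3 i j k hij hik hjk) X U V Z Y
    simp only [coeffsEll, SymCoeffs.map, map_mul, map_neg, map_zero] at this ⊢
    exact this

theorem laws_coeffsA2 (hK : K = 0) {p : ι → ι → MvPolynomial (Fin 4) ℂ}
    (hp : ∀ i j, p i j = (coeffsA2 (a i) (a j) (c i j)).poly) :
    ∃ h T, TetrahedronLaws (R := R) p h T := by
  subst hK
  obtain ⟨A, hA⟩ := H.exists_deriv
  have hA' : ∀ i j, i ≠ j → _ := fun i j hij => congrArg (algebraMap ℂ R) (hA i j hij)
  have h1 : ∀ i j k, i ≠ j → i ≠ k → j ≠ k → _ := fun i j k hij hik hjk =>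
    congrArg (algebraMap ℂ R) (H.rel i j k hij hik hjk)
  have h2 : ∀ i j k, i ≠ j → i ≠ k → j ≠ k → _ := fun i j k hij hik hjk =>
    congrArg (algebraMap ℂ R) (H.rel' i j k hij hik hjk)
  have h3 : ∀ i j k, i ≠ j → i ≠ k → j ≠ k → _ := fun i j k hij hik hjk =>
    congrArg (algebraMap ℂ R) (H.third hA hij hik hjk)
  simp only [map_mul, map_sub, map_add, map_pow, map_zero, map_ofNat, zero_mul, add_zero, sub_zero]
    at hA' h1 h2 h3
  refine ⟨_, _, .of_symCoeffs (fun i j => _) hp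
    -- The tetrahedron relation of `A2` is of type `Q3 0`.
    (fun i j k => ⟨0, 0, -c i j, c i k, -c j k, 0⟩)
    (fun i X U => (X 1 * U 1) ^ 2 + (X 0 * U 0) ^ 2
      - 2 * algebraMap ℂ R (A i) * (X 0 * X 1 * U 0 * U 1)) ?_ ?_ ?_ ?_ ?_⟩
  · intro i j hij
    ext <;> simp only [coeffsA2, swap, H.neg i j hij] <;> ring
  · intro i j k hij _ _
    ext <;> simp only [swap', H.neg i j hij] <;> ring
  · intro i j k _ _ hjk
    ext <;> simp only [swap, H.neg j k hjk] <;> ring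
  · intro i j hij
    refine ⟨a j * c i j, mul_ne_zero (H.ne_zero j) (H.ne_zero' i j hij), fun X U => ?_⟩
    rw [map_mul, ← disc_coeffsA2 (hA' i j hij)]
    simp only [coeffsA2, SymCoeffs.map, map_neg, map_zero]
  · intro i j k hij hik hjk
    refine ⟨a j * a k, mul_ne_zero (H.ne_zero j) (H.ne_zero k), fun X U V Z Y => ?_⟩
    have := tetra_coeffsA2 (h1 i j k hij hik hjk) (h2 i j k hij hik hjk) (hA' i j hij)
      (hA' i k hik) (h3 i j k hij hik hjk) X U V Z Y
    simp only [coeffsA2, SymCoeffs.map, map_mul, map_neg, map_zero] at this ⊢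
    exact this

end AdditionRelations

end

/-! ### Reducible face equations -/

section
variable {R : Type} [CommRing R] [Algebra ℂ R]

/-- The bilinear form of a matrix. -/
def bil (f : Matrix (Fin 2) (Fin 2) ℂ) (A B : Fin 2 → R) : R :=
  algebraMap ℂ R (f 0 0) * (A 0 * B 0) + algebraMap ℂ R (f 0 1) * (A 0 * B 1)
    + algebraMap ℂ R (f 1 0) * (A 1 * B 0) + algebraMap ℂ R (f 1 1) * (A 1 * B 1)

theorem map_bil {R' : Type} [CommRing R'] [Algebra ℂ R'] (φ : R →ₐ[ℂ] R')
    (f : Matrix (Fin 2) (Fin 2) ℂ) (A B : Fin 2 → R) :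
    φ (bil f A B) = bil f (φ ∘ A) (φ ∘ B) := by
  simp [bil]

theorem bil_act (m f : Matrix (Fin 2) (Fin 2) ℂ) (A B : Fin 2 → R) :
    bil f (act m A) (act m B) = bil (m.transpose * f * m) A B := by
  simp only [bil, act, Matrix.mul_apply, Fin.sum_univ_two, Matrix.transpose_apply, Matrix.cons_val,
    map_add, map_mul]
  ring

theorem exists_bil_eq_zero {f : Matrix (Fin 2) (Fin 2) ℂ} (hf : f.det ≠ 0) :
    ∃ s t : ℂ, bil f ![s, 1] ![t, 1] = 0 := by
  rw [Matrix.det_fin_two] at hf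
  by_cases h : f 1 0 = 0
  · have h0 : f 0 0 ≠ 0 := fun h0 => hf (by rw [h, h0]; ring)
    refine ⟨1, -(f 0 1 + f 1 1) / f 0 0, ?_⟩
    simp [bil, h]
    field_simp
    ring
  · refine ⟨0, -f 1 1 / f 1 0, ?_⟩
    simp [bil]
    field_simp
    ring

/-- Homogeneous coordinates of the transformed variable with number `n`. -/
def mobiusVar (m : GL (Fin 2) ℂ) (n : Fin 4) : Fin 2 → MvPolynomial (Fin 4) ℂ :=
  act m.1 ![MvPolynomial.X n, 1]

theorem mobius_eq_face (m : GL (Fin 2) ℂ) (p : MvPolynomial (Fin 4) ℂ) :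
    mobius m p = face p (mobiusVar m 0) (mobiusVar m 1) (mobiusVar m 2) (mobiusVar m 3) := by
  rw [mobius, face]
  congr 1 <;> ext i : 1 <;> fin_cases i <;> simp [mobiusVar, act, MvPolynomial.algebraMap_eq]

/-- The polynomial has a zero in affine space. Invertibility of `f` survives the congruence by `m`,
so no Möbius transformation can turn the form into a nonzero constant. -/
theorem not_isUnit_bil {f : Matrix (Fin 2) (Fin 2) ℂ} (hf : f.det ≠ 0) (m : GL (Fin 2) ℂ)
    {i j : Fin 4} (hij : i ≠ j) : ¬IsUnit (bil f (mobiusVar m i) (mobiusVar m j)) := by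
  intro hu
  have hdet : m.1.det ≠ 0 := m.isUnit.map Matrix.detMonoidHom |>.ne_zero
  have hf' : (m.1.transpose * f * m.1).det ≠ 0 := by
    simp [Matrix.det_mul, hf, hdet]
  obtain ⟨s, t, hst⟩ := exists_bil_eq_zero hf'
  let e : Fin 4 → ℂ := fun n => if n = i then s else t
  have h1 := (hu.map (MvPolynomial.aeval (R := ℂ) e)).ne_zero
  refine h1 ?_
  rw [mobiusVar, mobiusVar, bil_act, map_bil, ← hst]
  congr 1
  · ext n; fin_cases n <;> simp [e]
  · ext n; fin_cases n <;> simp [e, hij.symm]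

theorem not_irreducible_of_face_eq {m : GL (Fin 2) ℂ} {p : MvPolynomial (Fin 4) ℂ} {c : ℂ}
    {f g : Matrix (Fin 2) (Fin 2) ℂ} (hf : f.det ≠ 0) (hg : g.det ≠ 0) {i j k l : Fin 4}
    (hij : i ≠ j) (hkl : k ≠ l)
    (h : face p (mobiusVar m 0) (mobiusVar m 1) (mobiusVar m 2) (mobiusVar m 3)
      = MvPolynomial.C c * bil f (mobiusVar m i) (mobiusVar m j)
        * bil g (mobiusVar m k) (mobiusVar m l)) : ¬Irreducible (mobius m p) := by
  intro hirr
  rw [mobius_eq_face, h] at hirr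
  rcases hirr.isUnit_or_isUnit rfl with hu | hu
  · exact not_isUnit_bil hf m hij (isUnit_of_mul_isUnit_right hu)
  · exact not_isUnit_bil hg m hkl hu

end

namespace SymCoeffs

variable (m : GL (Fin 2) ℂ) {ε : ℂ}

/-- The factorization is `b (x + εu)(v + εy)`. -/
theorem not_irreducible_a (hε : ε ^ 2 = 1) (b : ℂ) :
    ¬Irreducible (mobius m (⟨0, 0, 0, b, ε * b, 0⟩ : SymCoeffs ℂ).poly) := by
  have h0 : ε ≠ 0 := by rintro rfl; norm_num at hε
  have h1 : (MvPolynomial.C ε : MvPolynomial (Fin 4) ℂ) ^ 2 = 1 := by rw [← map_pow, hε, map_one]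
  refine not_irreducible_of_face_eq (c := b) (f := !![0, 1; ε, 0]) (g := !![0, 1; ε, 0])
    (i := 0) (j := 1) (k := 2) (l := 3) (by simp [h0]) (by simp [h0]) (by decide) (by decide) ?_
  simp [face_poly, form, SymCoeffs.map, bil, MvPolynomial.algebraMap_eq]
  generalize mobiusVar m 0 = X, mobiusVar m 1 = U, mobiusVar m 2 = V, mobiusVar m 3 = Y
  linear_combination -(MvPolynomial.C b * (X 1 * U 0 * V 1 * Y 0)) * h1

/-- The factorization is `a (x + εy)(u + εv)`. -/
theorem not_irreducible_c (hε : ε ^ 2 = 1) (a : ℂ) :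
    ¬Irreducible (mobius m (⟨0, 0, a, ε * a, 0, 0⟩ : SymCoeffs ℂ).poly) := by
  have h0 : ε ≠ 0 := by rintro rfl; norm_num at hε
  have h1 : (MvPolynomial.C ε : MvPolynomial (Fin 4) ℂ) ^ 2 = 1 := by rw [← map_pow, hε, map_one]
  refine not_irreducible_of_face_eq (c := a) (f := !![0, 1; ε, 0]) (g := !![0, 1; ε, 0])
    (i := 0) (j := 3) (k := 1) (l := 2) (by simp [h0]) (by simp [h0]) (by decide) (by decide) ?_
  simp [face_poly, form, SymCoeffs.map, bil, MvPolynomial.algebraMap_eq]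
  generalize mobiusVar m 0 = X, mobiusVar m 1 = U, mobiusVar m 2 = V, mobiusVar m 3 = Y
  linear_combination -(MvPolynomial.C a * (X 1 * U 1 * V 0 * Y 0)) * h1

/-- The factorization is `εb (εxv + 1)(εuy + 1)`. -/
theorem not_irreducible_a' (hε : ε ^ 2 = 1) (b : ℂ) :
    ¬Irreducible (mobius m (⟨ε * b, 0, 0, b, 0, ε * b⟩ : SymCoeffs ℂ).poly) := by
  have h0 : ε ≠ 0 := by rintro rfl; norm_num at hε
  have h1 : (MvPolynomial.C ε : MvPolynomial (Fin 4) ℂ) ^ 2 = 1 := by rw [← map_pow, hε, map_one]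
  refine not_irreducible_of_face_eq (c := ε * b) (f := !![ε, 0; 0, 1]) (g := !![ε, 0; 0, 1])
    (i := 0) (j := 2) (k := 1) (l := 3) (by simp [h0]) (by simp [h0]) (by decide) (by decide) ?_
  simp [face_poly, form, SymCoeffs.map, bil, MvPolynomial.algebraMap_eq]
  generalize mobiusVar m 0 = X, mobiusVar m 1 = U, mobiusVar m 2 = V, mobiusVar m 3 = Y
  linear_combination -(MvPolynomial.C ε * MvPolynomial.C b * (X 0 * U 0 * V 0 * Y 0) +
    MvPolynomial.C b * (X 0 * U 1 * V 0 * Y 1 + X 1 * U 0 * V 1 * Y 0)) * h1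

end SymCoeffs

/-! ### Theta functions -/

section
open Complex Real

theorem jacobiTheta₂_term_mul_even (z w τ : ℂ) (S D : ℤ) :
    jacobiTheta₂_term (S + D) z τ * jacobiTheta₂_term (S - D) w τ
      = jacobiTheta₂_term S (z + w) (2 * τ) * jacobiTheta₂_term D (z - w) (2 * τ) := by
  simp only [jacobiTheta₂_term, ← Complex.exp_add]
  congr 1
  push_cast
  ring

/-- Here `(S + D + 1)² + (S - D)² = 2(S + 1/2)² + 2(D + 1/2)²`; the half-integer shifts produce `θ₂`
of the doubled period. -/
theorem jacobiTheta₂_term_mul_odd (z w τ : ℂ) (S D : ℤ) :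
    jacobiTheta₂_term (S + D + 1) z τ * jacobiTheta₂_term (S - D) w τ
      = cexp (π * I * τ / 2 + π * I * (z + w)) * jacobiTheta₂_term S (z + w + τ) (2 * τ)
        * (cexp (π * I * τ / 2 + π * I * (z - w)) * jacobiTheta₂_term D (z - w + τ) (2 * τ)) := by
  simp only [jacobiTheta₂_term, ← Complex.exp_add]
  congr 1
  push_cast
  ring

/-- The theta function `θ₃` of the doubled period. -/
def thetaF (τ z : ℂ) : ℂ := jacobiTheta₂ z (2 * τ)

/-- The theta function `θ₂` of the doubled period. -/
def thetaG (τ z : ℂ) : ℂ := cexp (π * I * τ / 2 + π * I * z) * jacobiTheta₂ (z + τ) (2 * τ)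

/-- Summation over `ℤ × ℤ` in the variables half sum and half difference, sorted by parity. -/
theorem hasSum_of_add_sub {f : ℤ × ℤ → ℂ} {a b : ℂ}
    (h : HasSum (fun q : ℤ × ℤ => f (q.1 + q.2, q.1 - q.2)) a)
    (h' : HasSum (fun q : ℤ × ℤ => f (q.1 + q.2 + 1, q.1 - q.2)) b) : HasSum f (a + b) := by
  have he : Function.Injective fun q : ℤ × ℤ => (q.1 + q.2, q.1 - q.2) := by
    rintro ⟨a, b⟩ ⟨c, d⟩ h
    simp only [Prod.mk.injEq] at h ⊢
    omega
  have he' : Function.Injective fun q : ℤ × ℤ => (q.1 + q.2 + 1, q.1 - q.2) := by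
    rintro ⟨a, b⟩ ⟨c, d⟩ h
    simp only [Prod.mk.injEq] at h ⊢
    omega
  have hcompl : IsCompl (Set.range fun q : ℤ × ℤ => (q.1 + q.2, q.1 - q.2))
      (Set.range fun q : ℤ × ℤ => (q.1 + q.2 + 1, q.1 - q.2)) := by
    constructor
    · rw [Set.disjoint_left]
      rintro _ ⟨⟨a, b⟩, rfl⟩ ⟨⟨c, d⟩, h⟩
      simp only [Prod.mk.injEq] at h
      omega
    · rw [codisjoint_iff_le_sup]
      rintro ⟨m, n⟩ -
      rcases Int.even_or_odd' (m + n) with ⟨k, hk | hk⟩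
      · left
        refine ⟨(k, m - k), ?_⟩
        simp only [Prod.mk.injEq]
        omega
      · right
        refine ⟨(k, m - k - 1), ?_⟩
        simp only [Prod.mk.injEq]
        omega
  exact HasSum.add_isCompl hcompl (he.hasSum_range_iff.2 h) (he'.hasSum_range_iff.2 h')

theorem summable_norm_jacobiTheta₂_term {τ : ℂ} (hτ : 0 < τ.im) (z : ℂ) :
    Summable fun n => ‖jacobiTheta₂_term n z τ‖ :=
  ((summable_jacobiTheta₂_term_iff z τ).2 hτ).norm

theorem hasSum_mul_of_norm {f g : ℤ → ℂ} {a b : ℂ} (hf : HasSum f a) (hg : HasSum g b)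
    (hf' : Summable fun n => ‖f n‖) (hg' : Summable fun n => ‖g n‖) :
    HasSum (fun q : ℤ × ℤ => f q.1 * g q.2) (a * b) :=
  hf.mul hg (summable_mul_of_summable_norm hf' hg')

theorem jacobiTheta₂_mul {τ : ℂ} (hτ : 0 < τ.im) (z w : ℂ) :
    jacobiTheta₂ z τ * jacobiTheta₂ w τ
      = thetaF τ (z + w) * thetaF τ (z - w) + thetaG τ (z + w) * thetaG τ (z - w) := by
  have hτ2 : 0 < (2 * τ).im := by simpa using hτ
  have h0 := hasSum_mul_of_norm (hasSum_jacobiTheta₂_term z hτ) (hasSum_jacobiTheta₂_term w hτ)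
    (summable_norm_jacobiTheta₂_term hτ z) (summable_norm_jacobiTheta₂_term hτ w)
  have h1 := hasSum_mul_of_norm (hasSum_jacobiTheta₂_term (z + w) hτ2)
    (hasSum_jacobiTheta₂_term (z - w) hτ2)
    (summable_norm_jacobiTheta₂_term hτ2 _) (summable_norm_jacobiTheta₂_term hτ2 _)
  have hs (c z : ℂ) : Summable fun n => ‖c * jacobiTheta₂_term n z (2 * τ)‖ := by
    simpa only [norm_mul] using (summable_norm_jacobiTheta₂_term hτ2 z).mul_left ‖c‖
  have h2 := hasSum_mul_of_norm
    ((hasSum_jacobiTheta₂_term (z + w + τ) hτ2).mul_left (cexp (π * I * τ / 2 + π * I * (z + w))))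
    ((hasSum_jacobiTheta₂_term (z - w + τ) hτ2).mul_left (cexp (π * I * τ / 2 + π * I * (z - w))))
    (hs _ _) (hs _ _)
  refine h0.unique (hasSum_of_add_sub ?_ ?_)
  · simp only [jacobiTheta₂_term_mul_even]
    exact h1
  · simp only [jacobiTheta₂_term_mul_odd]
    exact h2

theorem thetaF_add_one (τ z : ℂ) : thetaF τ (z + 1) = thetaF τ z :=
  jacobiTheta₂_add_left _ _

theorem exp_add_pi_mul_I' (z : ℂ) : cexp (z + π * I) = -cexp z := by
  rw [Complex.exp_add, exp_pi_mul_I]; ring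

theorem thetaG_add_one (τ z : ℂ) : thetaG τ (z + 1) = -thetaG τ z := by
  rw [thetaG, thetaG, show z + 1 + τ = z + τ + 1 by ring, jacobiTheta₂_add_left,
    show π * I * τ / 2 + π * I * (z + 1) = (π * I * τ / 2 + π * I * z) + π * I by ring,
    exp_add_pi_mul_I', neg_mul]

theorem exp_mul_thetaF (τ z : ℂ) : cexp (π * I * τ / 2 + π * I * z) * thetaF τ (z + τ)
    = thetaG τ z := rfl

theorem exp_mul_thetaG (τ z : ℂ) : cexp (π * I * τ / 2 + π * I * z) * thetaG τ (z + τ)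
    = thetaF τ z := by
  rw [thetaG, thetaF, show z + τ + τ = z + 2 * τ by ring, jacobiTheta₂_add_left', ← mul_assoc,
    ← mul_assoc, ← Complex.exp_add, ← Complex.exp_add]
  ring_nf
  simp

variable (τ : UpperHalfPlane)

theorem theta4_mul (z w : ℂ) : theta4 τ z * theta4 τ w
    = thetaF τ (z + w) * thetaF τ (z - w) - thetaG τ (z + w) * thetaG τ (z - w) := by
  rw [theta4, theta4, jacobiTheta₂_mul τ.im_pos, show z + 1 / 2 + (w + 1 / 2) = z + w + 1 by ring,
    show z + 1 / 2 - (w + 1 / 2) = z - w by ring, thetaF_add_one, thetaG_add_one]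
  ring

/-- The two half-period shifts add up to `τ`, and a shift by `τ` interchanges `thetaF` and `thetaG`
up to an exponential; hence the mixed products. -/
theorem theta1_mul (z w : ℂ) : theta1 τ z * theta1 τ w
    = thetaF τ (z + w) * thetaG τ (z - w) - thetaG τ (z + w) * thetaF τ (z - w) := by
  have h1 : thetaF τ (z + w - 1 + τ) = thetaF τ (z + w + τ) := by
    rw [← thetaF_add_one]; ring_nf
  have h2 : thetaG τ (z + w - 1 + τ) = -thetaG τ (z + w + τ) := by
    rw [← neg_eq_iff_eq_neg, ← thetaG_add_one]; ring_nf
  have h3 : cexp (π * I * τ / 4 + π * I * (z - 1 / 2)) * cexp (π * I * τ / 4 + π * I * (w - 1 / 2))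
      = -cexp (π * I * τ / 2 + π * I * (z + w)) := by
    rw [← exp_add_pi_mul_I', ← Complex.exp_add, Complex.exp_eq_exp_iff_exists_int]
    exact ⟨-1, by push_cast; ring⟩
  have h4 := jacobiTheta₂_mul τ.im_pos (z - 1 / 2 + τ / 2) (w - 1 / 2 + τ / 2)
  rw [show z - 1 / 2 + (τ : ℂ) / 2 + (w - 1 / 2 + τ / 2) = z + w - 1 + τ by ring,
    show z - 1 / 2 + (τ : ℂ) / 2 - (w - 1 / 2 + τ / 2) = z - w by ring, h1, h2] at h4
  rw [theta1, theta1, theta2, theta2, mul_mul_mul_comm, h3]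
  refine (congrArg _ h4).trans ?_
  rw [← exp_mul_thetaF τ (z + w), ← exp_mul_thetaG τ (z + w)]
  ring

theorem theta4_neg (z : ℂ) : theta4 τ (-z) = theta4 τ z := by
  rw [theta4, theta4, ← jacobiTheta₂_neg_left, ← jacobiTheta₂_add_left]
  ring_nf

theorem theta1_neg (z : ℂ) : theta1 τ (-z) = -theta1 τ z := by
  have h := jacobiTheta₂_add_left' (z - 1 / 2 - τ / 2) τ
  rw [show z - 1 / 2 - (τ : ℂ) / 2 + τ = z - 1 / 2 + τ / 2 by ring] at h
  have h' : jacobiTheta₂ (-z - 1 / 2 + τ / 2) τ = jacobiTheta₂ (z - 1 / 2 - τ / 2) τ := by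
    rw [← jacobiTheta₂_neg_left, ← jacobiTheta₂_add_left (z - 1 / 2 - τ / 2)]
    ring_nf
  simp only [theta1, theta2, h, h', ← mul_assoc, ← neg_mul, ← Complex.exp_add]
  congr 1
  rw [← exp_add_pi_mul_I', Complex.exp_eq_exp_iff_exists_int]
  exact ⟨-1, by push_cast; ring⟩

/-- The factor in the half period shifts of `θ₁` and `θ₄`. -/
def shiftFactor (z : ℂ) : ℂ := cexp (-(π * I * τ / 4) - π * I * (z - 1 / 2))

theorem shiftFactor_ne_zero (z : ℂ) : shiftFactor τ z ≠ 0 := Complex.exp_ne_zero _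

theorem theta4_add_half (z : ℂ) : theta4 τ (z + τ / 2) = shiftFactor τ z * theta1 τ z := by
  have h : jacobiTheta₂ (z + τ / 2 + 1 / 2) τ = jacobiTheta₂ (z - 1 / 2 + τ / 2) τ := by
    rw [← jacobiTheta₂_add_left (z - 1 / 2 + τ / 2)]
    ring_nf
  rw [theta4, theta1, theta2, h, shiftFactor, ← mul_assoc, ← Complex.exp_add]
  ring_nf
  simp

theorem theta1_add_half (z : ℂ) : theta1 τ (z + τ / 2) = shiftFactor τ z * theta4 τ z := by
  have h := jacobiTheta₂_add_left' (z - 1 / 2) τ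
  have h' : jacobiTheta₂ (z - 1 / 2) τ = jacobiTheta₂ (z + 1 / 2) τ := by
    rw [← jacobiTheta₂_add_left (z - 1 / 2)]
    ring_nf
  rw [theta1, theta2, theta4, shiftFactor, show z + (τ : ℂ) / 2 - 1 / 2 + τ / 2 = z - 1 / 2 + τ by ring,
    h, h', ← mul_assoc, ← Complex.exp_add]
  congr 1
  rw [Complex.exp_eq_exp_iff_exists_int]
  exact ⟨0, by push_cast; ring⟩

/-- By the product formulas everything depends on `thetaF` and `thetaG` at three points. With `t =
G/F`, each quotient of a `θ₁` product by the matching `θ₄` product is `(t' - t)/(1 - tt')`, so this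
is the identity `tanh a + tanh b + tanh c = -tanh a tanh b tanh c` for `a + b + c = 0`. -/
theorem theta_relation (x y z : ℂ) :
    theta1 τ x * theta1 τ (y - z) * (theta4 τ y * theta4 τ (x - z)) * (theta4 τ z * theta4 τ (x - y))
    - theta1 τ y * theta1 τ (x - z) * (theta4 τ x * theta4 τ (y - z)) * (theta4 τ z * theta4 τ (x - y))
    + theta1 τ z * theta1 τ (x - y) * (theta4 τ x * theta4 τ (y - z)) * (theta4 τ y * theta4 τ (x - z))
    = theta1 τ x * theta1 τ (y - z) * (theta1 τ y * theta1 τ (x - z))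
      * (theta1 τ z * theta1 τ (x - y)) := by
  simp only [theta1_mul, theta4_mul]
  rw [show x + (y - z) = x + y - z by ring, show x - (y - z) = x - y + z by ring,
    show y + (x - z) = x + y - z by ring, show y - (x - z) = -x + y + z by ring,
    show z + (x - y) = x - y + z by ring, show z - (x - y) = -x + y + z by ring]
  ring

/-- Shifting all three arguments by `τ/2` exchanges `θ₁` and `θ₄` there and leaves the differences
alone. -/
theorem theta_relation' (x y z : ℂ) :
    theta4 τ x * theta1 τ (y - z) * (theta1 τ y * theta4 τ (x - z)) * (theta1 τ z * theta4 τ (x - y))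
    - theta4 τ y * theta1 τ (x - z) * (theta1 τ x * theta4 τ (y - z)) * (theta1 τ z * theta4 τ (x - y))
    + theta4 τ z * theta1 τ (x - y) * (theta1 τ x * theta4 τ (y - z)) * (theta1 τ y * theta4 τ (x - z))
    = theta4 τ x * theta1 τ (y - z) * (theta4 τ y * theta1 τ (x - z))
      * (theta4 τ z * theta1 τ (x - y)) := by
  have h := theta_relation τ (x + τ / 2) (y + τ / 2) (z + τ / 2)
  simp only [add_sub_add_right_eq_sub, theta1_add_half, theta4_add_half] at h
  refine mul_left_cancel₀ (mul_ne_zero (mul_ne_zero (shiftFactor_ne_zero τ x)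
    (shiftFactor_ne_zero τ y)) (shiftFactor_ne_zero τ z)) ?_
  linear_combination h

/-- The difference of the two sides is a multiple of `θ₁(z + w) θ₁(z - w) θ₄(0)²`. -/
theorem theta_sq_of_theta1_sub_eq_zero {z w : ℂ} (h : theta1 τ (z - w) = 0) :
    theta1 τ z ^ 2 * theta4 τ w ^ 2 = theta1 τ w ^ 2 * theta4 τ z ^ 2 := by
  have h1 := theta1_mul τ (z + w) (z - w)
  rw [h, mul_zero, show z + w + (z - w) = z + z by ring, show z + w - (z - w) = w + w by ring] at h1
  simp only [sq, theta1_mul, theta4_mul, sub_self]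
  linear_combination -(thetaF τ 0 ^ 2 - thetaG τ 0 ^ 2) * h1

/-! ### The function `sn` -/

theorem thetaArg_sub (a b : ℂ) : thetaArg τ (a - b) = thetaArg τ a - thetaArg τ b := sub_div _ _ _

theorem thetaArg_neg (a : ℂ) : thetaArg τ (-a) = -thetaArg τ a := neg_div _ _

theorem sn_neg (a : ℂ) : sn τ (-a) = -sn τ a := by
  rw [sn, sn, thetaArg_neg, theta1_neg, theta4_neg, neg_div, mul_neg]

/-- The normalization `k² N⁴ = 1` of `N = θ₃(0)/θ₂(0)`, multiplied by `N²` so that nonvanishing of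
the theta constants is not needed. -/
theorem modulus_sq_mul : modulus τ ^ 2 * (theta3 τ 0 / theta2 τ 0) ^ 6
    = (theta3 τ 0 / theta2 τ 0) ^ 2 := by
  rw [modulus]
  by_cases h2 : theta2 τ 0 = 0
  · simp [h2]
  by_cases h3 : theta3 τ 0 = 0
  · simp [h3]
  field_simp

theorem sn_relations {x y z : ℂ} (hx : theta4 τ (thetaArg τ x) ≠ 0)
    (hy : theta4 τ (thetaArg τ y) ≠ 0) (hz : theta4 τ (thetaArg τ z) ≠ 0)
    (hxy : theta4 τ (thetaArg τ (x - y)) ≠ 0) (hxz : theta4 τ (thetaArg τ (x - z)) ≠ 0)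
    (hyz : theta4 τ (thetaArg τ (y - z)) ≠ 0) :
    sn τ x * sn τ (y - z) - sn τ y * sn τ (x - z) + sn τ z * sn τ (x - y)
      - modulus τ ^ 2 * sn τ x * sn τ y * sn τ z * sn τ (x - y) * sn τ (x - z) * sn τ (y - z) = 0
    ∧ sn τ x * sn τ y * sn τ (x - y) - sn τ x * sn τ z * sn τ (x - z)
      + sn τ y * sn τ z * sn τ (y - z) - sn τ (x - y) * sn τ (x - z) * sn τ (y - z) = 0 := by
  have h1 := theta_relation τ (thetaArg τ x) (thetaArg τ y) (thetaArg τ z)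
  have h2 := theta_relation' τ (thetaArg τ x) (thetaArg τ y) (thetaArg τ z)
  have h3 := modulus_sq_mul τ
  simp only [sn, ← thetaArg_sub] at h1 h2 ⊢
  generalize theta3 τ 0 / theta2 τ 0 = N at *
  constructor
  · have h4 : theta1 τ (thetaArg τ x) / theta4 τ (thetaArg τ x)
        * (theta1 τ (thetaArg τ (y - z)) / theta4 τ (thetaArg τ (y - z)))
      - theta1 τ (thetaArg τ y) / theta4 τ (thetaArg τ y)
        * (theta1 τ (thetaArg τ (x - z)) / theta4 τ (thetaArg τ (x - z)))
      + theta1 τ (thetaArg τ z) / theta4 τ (thetaArg τ z)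
        * (theta1 τ (thetaArg τ (x - y)) / theta4 τ (thetaArg τ (x - y)))
      = theta1 τ (thetaArg τ x) / theta4 τ (thetaArg τ x)
        * (theta1 τ (thetaArg τ y) / theta4 τ (thetaArg τ y))
        * (theta1 τ (thetaArg τ z) / theta4 τ (thetaArg τ z))
        * (theta1 τ (thetaArg τ (x - y)) / theta4 τ (thetaArg τ (x - y)))
        * (theta1 τ (thetaArg τ (x - z)) / theta4 τ (thetaArg τ (x - z)))
        * (theta1 τ (thetaArg τ (y - z)) / theta4 τ (thetaArg τ (y - z))) := by
      field_simp
      linear_combination h1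
    linear_combination N ^ 2 * h4 - (theta1 τ (thetaArg τ x) / theta4 τ (thetaArg τ x)
        * (theta1 τ (thetaArg τ y) / theta4 τ (thetaArg τ y))
        * (theta1 τ (thetaArg τ z) / theta4 τ (thetaArg τ z))
        * (theta1 τ (thetaArg τ (x - y)) / theta4 τ (thetaArg τ (x - y)))
        * (theta1 τ (thetaArg τ (x - z)) / theta4 τ (thetaArg τ (x - z)))
        * (theta1 τ (thetaArg τ (y - z)) / theta4 τ (thetaArg τ (y - z)))) * h3
  · field_simp
    linear_combination N ^ 3 * h2

theorem sn_sq_eq_of_sn_sub_eq_zero {x y : ℂ} (hx : theta4 τ (thetaArg τ x) ≠ 0)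
    (hy : theta4 τ (thetaArg τ y) ≠ 0) (hxy : theta4 τ (thetaArg τ (x - y)) ≠ 0)
    (h : sn τ (x - y) = 0) : sn τ x ^ 2 = sn τ y ^ 2 := by
  rw [sn] at h
  rcases mul_eq_zero.1 h with h | h
  · simp [sn, h]
  · have h1 := (div_eq_zero_iff.1 h).resolve_right hxy
    rw [thetaArg_sub] at h1
    have h2 := theta_sq_of_theta1_sub_eq_zero τ h1
    have h3 : (theta1 τ (thetaArg τ x) / theta4 τ (thetaArg τ x)) ^ 2
        = (theta1 τ (thetaArg τ y) / theta4 τ (thetaArg τ y)) ^ 2 := by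
      field_simp
      linear_combination h2
    rw [sn, sn, mul_pow, mul_pow, h3]

end

/-! ### Nondegeneracy of the canonical forms -/

namespace SymCoeffs

theorem exists_eq_mul_of_sq_eq {a b : ℂ} (h : a ^ 2 = b ^ 2) : ∃ ε : ℂ, ε ^ 2 = 1 ∧ a = ε * b := by
  rcases sq_eq_sq_iff_eq_or_eq_neg.1 h with h | h
  · exact ⟨1, one_pow 2, by rw [h, one_mul]⟩
  · exact ⟨-1, by norm_num, by rw [h, neg_one_mul]⟩

section
variable {κ : SymCoeffs ℂ} {m : GL (Fin 2) ℂ} (hirr : Irreducible (mobius m κ.poly))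
include hirr

theorem false_of_a_eq_zero (h0 : κ.k₀ = 0) (h1 : κ.k₁ = 0) (h4 : κ.k₄ = 0) (ha : κ.a = 0)
    (h : κ.c ^ 2 = κ.b ^ 2) : False := by
  obtain ⟨k₀, k₁, a, b, c, k₄⟩ := κ
  obtain ⟨ε, hε, hc⟩ := exists_eq_mul_of_sq_eq h
  dsimp only at *
  subst h0 h1 h4 ha hc
  exact not_irreducible_a m hε b hirr

theorem false_of_c_eq_zero (h0 : κ.k₀ = 0) (h1 : κ.k₁ = 0) (h4 : κ.k₄ = 0) (hc : κ.c = 0)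
    (h : κ.b ^ 2 = κ.a ^ 2) : False := by
  obtain ⟨k₀, k₁, a, b, c, k₄⟩ := κ
  obtain ⟨ε, hε, hb⟩ := exists_eq_mul_of_sq_eq h
  dsimp only at *
  subst h0 h1 h4 hc hb
  exact not_irreducible_c m hε a hirr

theorem false_of_a_eq_zero' (h1 : κ.k₁ = 0) (ha : κ.a = 0) (hc : κ.c = 0) (h4 : κ.k₄ = κ.k₀)
    (h : κ.k₀ ^ 2 = κ.b ^ 2) : False := by
  obtain ⟨k₀, k₁, a, b, c, k₄⟩ := κ
  obtain ⟨ε, hε, h0⟩ := exists_eq_mul_of_sq_eq h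
  dsimp only at *
  subst h4 h1 ha hc h0
  exact not_irreducible_a' m hε b hirr

end

variable {κ : SymCoeffs ℂ}

theorem exists_edgeDisc_ne_zero (h1 : κ.k₁ = 0) (hb : κ.b ≠ 0) (hc : κ.c ≠ 0) :
    ∃ X U : Fin 2 → ℂ, edgeDisc κ.poly X U ≠ 0 := by
  refine ⟨![1, 0], ![0, 1], ?_⟩
  simp [edgeDisc_poly, disc, form, map, h1, hb, hc]

theorem exists_edgeDisc_ne_zero' (h1 : κ.k₁ = 0) (ha : κ.a ≠ 0) (h0 : κ.k₀ ≠ 0) :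
    ∃ X U : Fin 2 → ℂ, edgeDisc κ.poly X U ≠ 0 := by
  refine ⟨![0, 1], ![0, 1], ?_⟩
  simp [edgeDisc_poly, disc, form, map, h1, ha, h0]

end SymCoeffs

open SymCoeffs

/-- The hypotheses on a family of polynomials under which consistency follows. -/
structure RegularFamily (p : Fin 4 → Fin 4 → MvPolynomial (Fin 4) ℂ) : Prop where
  laws : ∃ h T, TetrahedronLaws (R := InitRing) p h T
  edge : ∀ i j, i ≠ j → ∃ X U : Fin 2 → ℂ, edgeDisc (p i j) X U ≠ 0
  diag : ∀ i j, i ≠ j → ∃ U V : Fin 2 → ℂ, diagDisc (p i j) U V ≠ 0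

section
variable {m : GL (Fin 2) ℂ} {α : Fin 4 → ℂ}

theorem ne_zero_of_irreducible {p : ℂ → ℂ → SymCoeffs ℂ}
    (hirr : ∀ i j, i ≠ j → Irreducible (mobius m (p (α i) (α j)).poly))
    (h : ∀ β, Irreducible (mobius m (p 0 β).poly) → False) (i : Fin 4) : α i ≠ 0 := by
  intro hi
  obtain ⟨j, hj⟩ := exists_ne i
  have := hirr i j hj.symm
  rw [hi] at this
  exact h _ this

theorem ne_of_irreducible {p : ℂ → ℂ → SymCoeffs ℂ}
    (hirr : ∀ i j, i ≠ j → Irreducible (mobius m (p (α i) (α j)).poly))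
    (h : ∀ β, Irreducible (mobius m (p β β).poly) → False) (i j : Fin 4) (hij : i ≠ j) :
    α i ≠ α j := by
  intro hi
  have := hirr i j hij
  rw [hi] at this
  exact h _ this

theorem regularFamily_Q1 {δ : ℂ}
    (hirr : ∀ i j, i ≠ j → Irreducible (bulk (.Q1 δ) m (α i) (α j))) :
    RegularFamily fun i j => (CanonicalForm.Q1 δ).poly (α i) (α j) := by
  simp only [bulk, poly_Q1] at hirr
  have h0 := ne_zero_of_irreducible hirr fun β h =>
    false_of_a_eq_zero h (by simp [coeffsQ1]) rfl rfl rfl (by simp [coeffsQ1])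
  have h1 := ne_of_irreducible hirr fun β h =>
    false_of_c_eq_zero h (by simp [coeffsQ1]) rfl rfl (by simp [coeffsQ1]) (by simp [coeffsQ1])
  refine ⟨laws_Q1 δ h0 h1, fun i j hij => ?_, fun i j hij => ?_⟩ <;> rw [poly_Q1]
  · exact exists_edgeDisc_ne_zero rfl (neg_ne_zero.2 (h0 j)) (sub_ne_zero.2 (h1 i j hij).symm)
  · exact exists_diagDisc_ne_zero (h0 i) (neg_ne_zero.2 (h0 j))

theorem regularFamily_Q2 (hirr : ∀ i j, i ≠ j → Irreducible (bulk .Q2 m (α i) (α j))) :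
    RegularFamily fun i j => CanonicalForm.Q2.poly (α i) (α j) := by
  simp only [bulk, poly_Q2] at hirr
  have h0 := ne_zero_of_irreducible hirr fun β h =>
    false_of_a_eq_zero h (by simp [coeffsQ2]) (by simp [coeffsQ2]) rfl rfl (by simp [coeffsQ2])
  have h1 := ne_of_irreducible hirr fun β h =>
    false_of_c_eq_zero h (by simp [coeffsQ2]) (by simp [coeffsQ2]) rfl (by simp [coeffsQ2])
      (by simp [coeffsQ2])
  refine ⟨laws_Q2 h0 h1, fun i j hij => ⟨![1, 0], ![0, 1], ?_⟩, fun i j hij => ?_⟩ <;> rw [poly_Q2]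
  · have h2 := sub_ne_zero.2 (h1 i j hij).symm
    simp [edgeDisc_poly, disc, form, SymCoeffs.map, coeffsQ2, h0 j, h2]
  · exact exists_diagDisc_ne_zero (h0 i) (neg_ne_zero.2 (h0 j))

theorem regularFamily_A1 {δ : ℂ}
    (hirr : ∀ i j, i ≠ j → Irreducible (bulk (.A1 δ) m (α i) (α j))) :
    RegularFamily fun i j => (CanonicalForm.A1 δ).poly (α i) (α j) := by
  simp only [bulk, poly_A1] at hirr
  have h0 := ne_zero_of_irreducible hirr fun β h =>
    false_of_a_eq_zero h (by simp [coeffsA1]) rfl rfl rfl (by simp [coeffsA1])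
  have h1 := ne_of_irreducible hirr fun β h =>
    false_of_c_eq_zero h (by simp [coeffsA1]) rfl rfl (by simp [coeffsA1]) (by simp [coeffsA1])
  refine ⟨laws_A1 δ h0 h1, fun i j hij => ?_, fun i j hij => ?_⟩ <;> rw [poly_A1]
  · exact exists_edgeDisc_ne_zero rfl (neg_ne_zero.2 (h0 j)) (sub_ne_zero.2 (h1 i j hij))
  · exact exists_diagDisc_ne_zero (h0 i) (neg_ne_zero.2 (h0 j))

theorem regularFamily_H1 (hirr : ∀ i j, i ≠ j → Irreducible (bulk .H1 m (α i) (α j))) :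
    RegularFamily fun i j => CanonicalForm.H1.poly (α i) (α j) := by
  simp only [bulk, poly_H1] at hirr
  have h1 := ne_of_irreducible hirr fun β h =>
    false_of_c_eq_zero h (by simp [coeffsH1]) rfl rfl rfl (by simp [coeffsH1])
  refine ⟨laws_H1 h1, fun i j hij => ?_, fun i j hij => ?_⟩ <;> rw [poly_H1]
  · exact exists_edgeDisc_ne_zero' rfl one_ne_zero (sub_ne_zero.2 (h1 i j hij).symm)
  · exact exists_diagDisc_ne_zero one_ne_zero (neg_ne_zero.2 one_ne_zero)

theorem regularFamily_H2 (hirr : ∀ i j, i ≠ j → Irreducible (bulk .H2 m (α i) (α j))) :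
    RegularFamily fun i j => CanonicalForm.H2.poly (α i) (α j) := by
  simp only [bulk, poly_H2] at hirr
  have h1 := ne_of_irreducible hirr fun β h =>
    false_of_c_eq_zero h (by simp [coeffsH2]) (by simp [coeffsH2]) rfl rfl (by simp [coeffsH2])
  -- The point is chosen so that the edge biquadratic `x + u + αᵢ` equals `1`.
  refine ⟨laws_H2 h1, fun i j hij => ⟨![1 - α i, 1], ![0, 1], ?_⟩, fun i j hij => ?_⟩ <;>
    rw [poly_H2]
  · have h2 : (2 : ℂ) * (α j - α i) ≠ 0 :=
      mul_ne_zero two_ne_zero (sub_ne_zero.2 (h1 i j hij).symm)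
    convert h2 using 1
    simp [edgeDisc_poly, disc, form, SymCoeffs.map, coeffsH2]
    ring
  · exact exists_diagDisc_ne_zero one_ne_zero (neg_ne_zero.2 one_ne_zero)

theorem regularFamily_H3 {δ : ℂ}
    (hirr : ∀ i j, i ≠ j → Irreducible (bulk (.H3 δ) m (α i) (α j))) :
    RegularFamily fun i j => (CanonicalForm.H3 δ).poly (α i) (α j) := by
  simp only [bulk, poly_H3] at hirr
  have h1 : ∀ i j, i ≠ j → Complex.exp (α i) ^ 2 ≠ Complex.exp (α j) ^ 2 := fun i j hij h =>
    false_of_c_eq_zero (hirr i j hij) (by simp [coeffsH3, h]) rfl rfl rfl (by simp [coeffsH3, h])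
  -- Here the edge biquadratic `xu + δ exp αᵢ` equals `1`.
  refine ⟨laws_H3 δ h1, fun i j hij => ⟨![1 - δ * Complex.exp (α i), 1], ![1, 1], ?_⟩,
    fun i j hij => ?_⟩ <;> rw [poly_H3]
  · convert sub_ne_zero.2 (h1 i j hij) using 1
    simp [edgeDisc_poly, disc, form, SymCoeffs.map, coeffsH3]
    ring
  · exact exists_diagDisc_ne_zero (Complex.exp_ne_zero _) (neg_ne_zero.2 (Complex.exp_ne_zero _))

theorem poly_Q3 (δ α β : ℂ) : (CanonicalForm.Q3 δ).poly α β
    = (coeffsEll δ 0 (Complex.sinh α) (Complex.sinh β) (Complex.sinh (α - β))).poly := by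
  simp only [CanonicalForm.poly, SymCoeffs.poly, coeffsEll, map_mul, map_neg, map_zero]
  ring

theorem poly_Q4 (τ : UpperHalfPlane) (α β : ℂ) : (CanonicalForm.Q4 τ).poly α β
    = (coeffsEll 1 (modulus τ ^ 2) (sn τ α) (sn τ β) (sn τ (α - β))).poly := by
  simp only [CanonicalForm.poly, SymCoeffs.poly, coeffsEll, map_mul, map_neg, map_zero, map_one]
  ring

theorem poly_A2 (α β : ℂ) : CanonicalForm.A2.poly α β
    = (coeffsA2 (Complex.sinh α) (Complex.sinh β) (Complex.sinh (α - β))).poly := by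
  simp only [CanonicalForm.poly, SymCoeffs.poly, coeffsA2, map_neg, map_zero]
  ring

theorem additionRelations_sinh (h0 : ∀ i, Complex.sinh (α i) ≠ 0)
    (h1 : ∀ i j, i ≠ j → Complex.sinh (α i - α j) ≠ 0) :
    AdditionRelations 0 (fun i => Complex.sinh (α i)) fun i j => Complex.sinh (α i - α j) where
  neg i j _ := by rw [← Complex.sinh_neg, neg_sub]
  ne_zero := h0
  ne_zero' := h1
  rel i j k _ _ _ := by simp only [Complex.sinh_sub]; ring
  rel' i j k _ _ _ := by
    have hi := Complex.cosh_sq (α i)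
    have hj := Complex.cosh_sq (α j)
    have hk := Complex.cosh_sq (α k)
    simp only [Complex.sinh_sub]
    generalize Complex.cosh (α i) = A at *
    generalize Complex.cosh (α j) = B at *
    generalize Complex.cosh (α k) = D at *
    generalize Complex.sinh (α i) = a at *
    generalize Complex.sinh (α j) = b at *
    generalize Complex.sinh (α k) = d at *
    linear_combination -(a ^ 2 * b * B - a * A * b ^ 2) * hk - (a * A * d ^ 2 - a ^ 2 * d * D) * hj
      - (b ^ 2 * d * D - b * B * d ^ 2) * hi

/-- From `sinh² x - sinh² y = sinh (x + y) sinh (x - y)`. -/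
theorem sinh_sq_eq_of_sinh_sub_eq_zero {x y : ℂ} (h : Complex.sinh (x - y) = 0) :
    Complex.sinh x ^ 2 = Complex.sinh y ^ 2 := by
  have hx := Complex.cosh_sq x
  have hy := Complex.cosh_sq y
  rw [Complex.sinh_sub] at h
  linear_combination -Complex.sinh x ^ 2 * hy + Complex.sinh y ^ 2 * hx
    + (Complex.sinh x * Complex.cosh y + Complex.cosh x * Complex.sinh y) * h

theorem sinh_sub_sq_of_sinh_eq_zero {x : ℂ} (h : Complex.sinh x = 0) (y : ℂ) :
    Complex.sinh (x - y) ^ 2 = Complex.sinh y ^ 2 := by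
  rw [Complex.sinh_sub, h, ← neg_sub, neg_sq, zero_mul, sub_zero, mul_pow, Complex.cosh_sq, h]
  ring

theorem regularFamily_Q3 {δ : ℂ}
    (hirr : ∀ i j, i ≠ j → Irreducible (bulk (.Q3 δ) m (α i) (α j))) :
    RegularFamily fun i j => (CanonicalForm.Q3 δ).poly (α i) (α j) := by
  simp only [bulk, poly_Q3] at hirr
  have h0 : ∀ i, Complex.sinh (α i) ≠ 0 := by
    intro i h
    obtain ⟨j, hj⟩ := exists_ne i
    exact false_of_a_eq_zero (hirr i j hj.symm) (by simp [coeffsEll, h]) rfl (by simp [coeffsEll])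
      h (by simpa [coeffsEll] using sinh_sub_sq_of_sinh_eq_zero h _)
  have h1 : ∀ i j, i ≠ j → Complex.sinh (α i - α j) ≠ 0 := fun i j hij h =>
    false_of_c_eq_zero (hirr i j hij) (by simp [coeffsEll, h]) rfl (by simp [coeffsEll])
      (by simp [coeffsEll, h]) (by simpa [coeffsEll] using (sinh_sq_eq_of_sinh_sub_eq_zero h).symm)
  refine ⟨(additionRelations_sinh h0 h1).laws_coeffsEll (mul_zero δ).symm fun i j => poly_Q3 _ _ _,
    fun i j hij => ?_, fun i j hij => ?_⟩ <;> rw [poly_Q3]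
  · exact exists_edgeDisc_ne_zero rfl (neg_ne_zero.2 (h0 j)) (neg_ne_zero.2 (h1 i j hij))
  · exact exists_diagDisc_ne_zero (h0 i) (neg_ne_zero.2 (h0 j))

theorem regularFamily_A2 (hirr : ∀ i j, i ≠ j → Irreducible (bulk .A2 m (α i) (α j))) :
    RegularFamily fun i j => CanonicalForm.A2.poly (α i) (α j) := by
  simp only [bulk, poly_A2] at hirr
  have h0 : ∀ i, Complex.sinh (α i) ≠ 0 := by
    intro i h
    obtain ⟨j, hj⟩ := exists_ne i
    -- In `A2` the coefficient of `xu + vy` comes from the second parameter, so the face is taken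
    -- with the indices in the order `j, i`.
    refine false_of_a_eq_zero' (hirr j i hj) rfl (by simp [coeffsA2, h]) rfl rfl ?_
    simpa only [coeffsA2, ← neg_sub (α i), Complex.sinh_neg, neg_neg]
      using sinh_sub_sq_of_sinh_eq_zero h (α j)
  have h1 : ∀ i j, i ≠ j → Complex.sinh (α i - α j) ≠ 0 := fun i j hij h =>
    false_of_c_eq_zero (hirr i j hij) (by simp [coeffsA2, h]) rfl (by simp [coeffsA2, h])
      rfl (by simpa [coeffsA2] using sinh_sq_eq_of_sinh_sub_eq_zero h)
  refine ⟨(additionRelations_sinh h0 h1).laws_coeffsA2 rfl fun i j => poly_A2 _ _,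
    fun i j hij => ?_, fun i j hij => ?_⟩ <;> rw [poly_A2]
  · exact exists_edgeDisc_ne_zero' rfl (neg_ne_zero.2 (h0 j)) (neg_ne_zero.2 (h1 i j hij))
  · exact exists_diagDisc_ne_zero (neg_ne_zero.2 (h0 j)) (h0 i)

theorem regularFamily_Q4 {τ : UpperHalfPlane} (hdef : ∀ i, theta4 τ (thetaArg τ (α i)) ≠ 0)
    (hdef' : ∀ i j, i ≠ j → theta4 τ (thetaArg τ (α i - α j)) ≠ 0)
    (hirr : ∀ i j, i ≠ j → Irreducible (bulk (.Q4 τ) m (α i) (α j))) :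
    RegularFamily fun i j => (CanonicalForm.Q4 τ).poly (α i) (α j) := by
  simp only [bulk, poly_Q4] at hirr
  have h0 : ∀ i, sn τ (α i) ≠ 0 := by
    intro i h
    obtain ⟨j, hj⟩ := exists_ne i
    refine false_of_a_eq_zero (hirr i j hj.symm) (by simp [coeffsEll, h]) rfl
      (by simp [coeffsEll, h]) h ?_
    have hj' : theta4 τ (thetaArg τ (-α j)) ≠ 0 := by
      rw [thetaArg_neg, theta4_neg]
      exact hdef j
    have hi : α i - α j - -α j = α i := by ring
    -- Applied to `αᵢ - αⱼ` and `-αⱼ`, whose difference `αᵢ` is the given zero of `sn`.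
    have := sn_sq_eq_of_sn_sub_eq_zero τ (hdef' i j hj.symm) hj' (by rw [hi]; exact hdef i)
      (by rw [hi]; exact h)
    simpa [coeffsEll, sn_neg] using this
  have h1 : ∀ i j, i ≠ j → sn τ (α i - α j) ≠ 0 := fun i j hij h =>
    false_of_c_eq_zero (hirr i j hij) (by simp [coeffsEll, h]) rfl (by simp [coeffsEll, h])
      (by simp [coeffsEll, h]) (by simpa [coeffsEll] using
        (sn_sq_eq_of_sn_sub_eq_zero τ (hdef i) (hdef j) (hdef' i j hij) h).symm)
  have hadd : AdditionRelations (modulus τ ^ 2) (fun i => sn τ (α i))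
      fun i j => sn τ (α i - α j) :=
    { neg := fun i j _ => by rw [← sn_neg, neg_sub]
      ne_zero := h0
      ne_zero' := h1
      rel := fun i j k hij hik hjk => (sn_relations τ (hdef i) (hdef j) (hdef k) (hdef' i j hij)
        (hdef' i k hik) (hdef' j k hjk)).1
      rel' := fun i j k hij hik hjk => (sn_relations τ (hdef i) (hdef j) (hdef k) (hdef' i j hij)
        (hdef' i k hik) (hdef' j k hjk)).2 }
  refine ⟨hadd.laws_coeffsEll (one_mul _).symm fun i j => poly_Q4 _ _ _,
    fun i j hij => ?_, fun i j hij => ?_⟩ <;> rw [poly_Q4]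
  · exact exists_edgeDisc_ne_zero rfl (neg_ne_zero.2 (h0 j)) (neg_ne_zero.2 (h1 i j hij))
  · exact exists_diagDisc_ne_zero (h0 i) (neg_ne_zero.2 (h0 j))

theorem regularFamily_poly {F : CanonicalForm} (hdef : ∀ i, F.DefinedAt (α i))
    (hdef' : ∀ i j, i ≠ j → F.DefinedAt (α i - α j))
    (hirr : ∀ i j, i ≠ j → Irreducible (bulk F m (α i) (α j))) :
    RegularFamily fun i j => F.poly (α i) (α j) := by
  cases F with
  | Q1 δ => exact regularFamily_Q1 hirr
  | Q2 => exact regularFamily_Q2 hirr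
  | Q3 δ => exact regularFamily_Q3 hirr
  | Q4 τ => exact regularFamily_Q4 hdef hdef' hirr
  | H1 => exact regularFamily_H1 hirr
  | H2 => exact regularFamily_H2 hirr
  | H3 δ => exact regularFamily_H3 hirr
  | A1 δ => exact regularFamily_A1 hirr
  | A2 => exact regularFamily_A2 hirr

end

end ABS

end

/-- Consistency of the bulk equations around a rhombic dodecahedron: any two of the four ways of
computing `x₁₂₃₄` that can be carried out give the same value, and for generic initial values (outside
the zero set of a nonzero polynomial) all four of them can be carried out. -/
theorem theorem3p1 (F : ABS.CanonicalForm) (m : GL (Fin 2) ℂ) (α : Fin 4 → ℂ)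
    (hdef : ∀ i, F.DefinedAt (α i))
    (hdef' : ∀ i j, i ≠ j → F.DefinedAt (α i - α j))
    (hirr : ∀ i j, i ≠ j → Irreducible (ABS.bulk F m (α i) (α j))) :
    (∀ (x : ABS.CP1) (v : Fin 4 → ABS.CP1) (w w' : Fin 4) (y y' : ABS.CP1),
      ABS.Way (ABS.bulk F m) α x v w y → ABS.Way (ABS.bulk F m) α x v w' y' → y = y') ∧
    (∃ P : MvPolynomial (Fin 5) ℂ, P ≠ 0 ∧ ∀ d : Fin 5 → ℂ, MvPolynomial.eval d P ≠ 0 →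
      ∃ y : ABS.CP1, ∀ w : Fin 4,
        ABS.Way (ABS.bulk F m) α (ABS.ofComplex (d 0)) (fun i => ABS.ofComplex (d i.succ)) w y) := by
  have h := ABS.regularFamily_poly hdef hdef' hirr
  exact ABS.consistent_of_laws F m α h.laws h.edge h.diag
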